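/- Let $\lambda_1,\lambda_2>0$ and $\mu_2\ge 0$. Let $S=\bigcup_{n\ge1}\mathbb N^n$ with $\mathbb N=\{0,1,2,\dots\}$; for $\mathbf x=(x^1,\dots,x^n)\in S$ write $\ell(\mathbf x)=n$ and $\|\mathbf x\|=\sum_{i=1}^n x^i$. Let $\mathbf d=(\mathbf d_t)_{t\in\mathbb N}$, $\mathbf d_t=(d_t^1,\dots,d_t^{\ell(\mathbf d_t)})$, be the discrete-time Markov chain on $S$ with $\mathbf d_0=(1)$ almost surely and the following transitions from $\mathbf x\in S$. Put $N(\mathbf x)=(\lambda_2+\mu_2)\|\mathbf x\|+\ell(\mathbf x)\lambda_1$. For each $1\le i\le\ell(\mathbf x)$, the entry $x^i$ is increased by $1$ with probability $x^i\lambda_2/N(\mathbf x)$ and decreased by $1$ with probability $x^i\mu_2/N(\mathbf x)$; with probability $\ell(\mathbf x)\lambda_1/N(\mathbf x)$ a new last entry equal to $1$ is appended. (The entries of $\mathbf d_t$ are the in-degrees of the vertices of a random graph with preferential attachment and detachment of edges.) Let $d(V_t)$ be an $\mathbb N$-valued random variable with $$\mathbb P(d(V_t)=j\mid \ell(\mathbf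 d_t)=n)=\frac1n\sum_{i=1}^n\mathbb P(d_t^i=j\mid \ell(\mathbf d_t)=n)$$ for all $j\in\mathbb N$ and all $n\ge1$ with $\mathbb P(\ell(\mathbf d_t)=n)>0$, that is, the in-degree at time $t$ of a vertex chosen uniformly at random. Let $\mathbf B(a,b)=\int_0^1 s^{a-1}(1-s)^{b-1}\,ds$ for $a,b>0$; let ${}_2\mathbf F_1(a,b,c,z)=\frac1{\mathbf B(b,c-b)}\int_0^1 s^{b-1}\frac{(1-s)^{c-b-1}}{(1-sz)^a}\,ds$ for $a>0$, $c>b>0$, $0<z<1$; and let $\mathbf U(a,b,z)=\frac1{\Gamma(a)}\int_0^\infty e^{-zs}s^{a-1}(1+s)^{b-a-1}\,ds$ for $a,z>0$, $b\in\mathbb R$. Then for every $j\in\mathbb N$ the limit $p_j=\lim_{t\to\infty}\mathbb P(d(V_t)=j)$ exists, and the limits are as follows. (i) If $\mu_2=0$, then $p_0=0$ and $p_j=\frac{\lambda_1}{\lambda_2}\mathbf B\big(j,1+\frac{\lambda_1}{\lambda_2}\big)$ for $j\ge1$. (ii) If $\mu_2>0$ and $\lambda_2>\mu_2$, then with $r=\frac{\lambda_1}{\lambda_2-\mu_2}$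 $$p_0=\frac{\mu_2\lambda_1}{\lambda_2(\lambda_2-\mu_2)}\mathbf B(2,r)\,{}_2\mathbf F_1\Big(1,r,2+r,\frac{\mu_2}{\lambda_2}\Big),$$ $$p_j=\frac{\lambda_1(\lambda_2-\mu_2)}{\lambda_2^2}\mathbf B(j,1+r)\,{}_2\mathbf F_1\Big(j+1,1+r,j+1+r,\frac{\mu_2}{\lambda_2}\Big),\quad j\ge1.$$ (iii) If $\mu_2>0$ and $\lambda_2<\mu_2$, then with $r=\frac{\lambda_1}{\mu_2-\lambda_2}$ $$p_0=\frac{\lambda_1}{\mu_2-\lambda_2}\mathbf B(2,r)\,{}_2\mathbf F_1\Big(1,r,2+r,\frac{\lambda_2}{\mu_2}\Big),$$ $$p_j=\Big(\frac{\lambda_2}{\mu_2}\Big)^{j+1}\frac{\lambda_1(\mu_2-\lambda_2)}{\lambda_2^2}\mathbf B(j,1+r)\,{}_2\mathbf F_1\Big(j+1,1+r,j+1+r,\frac{\lambda_2}{\mu_2}\Big),\quad j\ge1.$$ (iv) If $\mu_2>0$ and $\lambda_2=\mu_2$, then $p_0=\mathbf U\big(1,0,\frac{\lambda_1}{\lambda_2}\big)$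 and $p_j=\frac{\lambda_1}{\lambda_2}\Gamma(j)\,\mathbf U\big(j,0,\frac{\lambda_1}{\lambda_2}\big)$ for $j\ge1$. -/

import Mathlib

open MeasureTheory ProbabilityTheory Filter Topology
open scoped BigOperators

/-- The state space `S = ⋃_{n ≥ 1} ℕ^n`: finite nonempty sequences `(x¹, …, xⁿ)` of
natural numbers. -/
def DegSeq : Type := {x : List ℕ // x ≠ []}

/-- `S` is countable and carries the discrete σ-algebra. -/
instance : MeasurableSpace DegSeq := ⊤

namespace DegSeq

/-- The length `ℓ(x)`. -/
def len (x : DegSeq) : ℕ := x.1.length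

/-- The norm `‖x‖ = ∑_j x^j`. -/
def total (x : DegSeq) : ℕ := x.1.sum

/-- The entry of `x` at position `i`, where positions are counted from `0`; it is `0` when
`i ≥ ℓ(x)`. -/
def entry (x : DegSeq) (i : ℕ) : ℕ := x.1.getD i 0

/-- The sequence `(1)` of length one. -/
def one : DegSeq := ⟨[1], by simp⟩

open Classical in
/-- The transition probability `p_{x,y}`: one entry goes up by one, or one entry goes down by one,
or an entry `1` is appended. The target sequences listed here are pairwise different, so at most
one of the summands is nonzero; a down-step from an entry `0` has weight `0`. -/
noncomputable def trans (l1 l2 m2 : ℝ) (x y : DegSeq) : ℝ :=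
  ((∑ i ∈ Finset.range x.len,
      if y.1 = x.1.modify i (fun k => k + 1) then (x.entry i : ℝ) * l2 else 0)
    + (∑ i ∈ Finset.range x.len,
      if y.1 = x.1.modify i (fun k => k - 1) then (x.entry i : ℝ) * m2 else 0)
    + (if y.1 = x.1 ++ [1] then (x.len : ℝ) * l1 else 0))
  / ((l2 + m2) * (x.total : ℝ) + (x.len : ℝ) * l1)

end DegSeq

/-- `d = (d_t)_{t ∈ ℕ}` is, under `P`, a discrete-time Markov chain on `S` with transition
probabilities `p_{x,y}` and initial distribution `δ_{(1)}`. -/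
structure IsInDegreeChain {Ω : Type*} [MeasurableSpace Ω] (l1 l2 m2 : ℝ) (P : Measure Ω)
    (d : ℕ → Ω → DegSeq) : Prop where
  measurable : ∀ t, Measurable (d t)
  init : P.real {ω | d 0 ω = DegSeq.one} = 1
  step : ∀ (t : ℕ) (x : ℕ → DegSeq) (y : DegSeq),
    P.real {ω | (∀ s ≤ t, d s ω = x s) ∧ d (t + 1) ω = y}
      = P.real {ω | ∀ s ≤ t, d s ω = x s} * DegSeq.trans l1 l2 m2 (x t) y

/-- For each `t`, the random variable `D t` is the in-degree of a uniformly chosen vertex at time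
`t`: for all `n ≥ 1` and `j`,
`P(D t = j | ℓ(d_t) = n) = (1/n) ∑_{i=1}^n P(d_t^i = j | ℓ(d_t) = n)`.
If `P(ℓ(d_t) = n) = 0`, both sides are `0` and nothing is required. -/
structure IsUniformVertexDegree {Ω : Type*} [MeasurableSpace Ω] (P : Measure Ω)
    (d : ℕ → Ω → DegSeq) (D : ℕ → Ω → ℕ) : Prop where
  measurable : ∀ t, Measurable (D t)
  cond_eq : ∀ t n j : ℕ, 1 ≤ n →
    (P[|{ω | (d t ω).len = n}]).real {ω | D t ω = j}
      = (1 / (n : ℝ)) * ∑ i ∈ Finset.range n,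
          (P[|{ω | (d t ω).len = n}]).real {ω | (d t ω).entry i = j}

/-- The Gauss hypergeometric function
`₂F₁(a,b,c,z) = B(b,c-b)⁻¹ ∫₀¹ s^{b-1} (1-s)^{c-b-1} (1-sz)^{-a} ds`,
for `c > b > 0` and `0 < z < 1`. -/
noncomputable def gaussF (a b c z : ℝ) : ℝ :=
  (1 / ProbabilityTheory.beta b (c - b)) *
    ∫ s in (0 : ℝ)..1, s ^ (b - 1) * ((1 - s) ^ (c - b - 1) / (1 - s * z) ^ a)

/-- The confluent hypergeometric function
`U(a,b,z) = Γ(a)⁻¹ ∫₀^∞ e^{-zs} s^{a-1} (1+s)^{b-a-1} ds`, for `a > 0`, `z > 0` and real `b`. -/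
noncomputable def confluentU (a b z : ℝ) : ℝ :=
  (1 / Real.Gamma a) *
    ∫ s in Set.Ioi (0 : ℝ), Real.exp (-z * s) * s ^ (a - 1) * (1 + s) ^ (b - a - 1)

/-!
In continuous time, where each transition occurs at the rate given by its unnormalised weight, the
vertices are born according to a Yule process of rate `λ₁`, and the degree of each vertex is a linear
birth-death process started from one, with birth rate `λ₂` and death rate `μ₂`. The age of a typical
vertex is exponential of rate `λ₁`, so the limit law should be that of the birth-death process at an
independent exponential time. This is `degreeLaw`; it is stationary for the evolution of the
empirical degree distribution (`degreeLaw.stationary_zero`, `degreeLaw.stationary_succ`), and the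
hypergeometric formulas come from the explicit birth-death law by a change of variables.

The convergence is proved for the discrete chain itself, by a second moment estimate. Let `φ` be a
Hilbert space valued function of a degree, `c` its mean under `degreeLaw`, and
`Y = ∑ i, (φ (xⁱ) - c)`. By stationarity the drift of `Y` is the (unbounded) birth-death generator
applied to `Y`. If this generator is nearly dissipative in the chosen Hilbert space, the drift of
`‖Y‖²` is at most of the order of the number of vertices `n`, apart from a small multiple of `‖Y‖²`.
Then `‖Y‖² n ^ (-3/2)`, corrected by a multiple of `n ^ (-1/2)` and of a superharmonic sum that
dominates the quadratic variation, is a supermartingale, so `E[‖Y‖² n ^ (-3/2)]` stays bounded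
(`IsDegreeStatistic.exists_seqGen_nonpos`, `IsInDegreeChain.exists_lintegral_norm_sq_le`). Since `n`
tends to infinity (`IsInDegreeChain.tendsto_lintegral_inv_sqrt`), `‖Y‖ / n` tends to zero in mean
(`IsInDegreeChain.tendsto_real_eq`).

Two choices of `φ` cover all parameters. For `λ₂ ≤ μ₂` the coordinates of `φ` are the indicators of
the tails `{k > i}` (`tailStat`); the generator is dissipative because degrees have no upward drift,
and the total degree is superharmonic. For `μ₂ < λ₂` they are the indicators of single degrees with
geometrically decaying weights (`pointStat`), so that the mass escaping to infinity is not seen.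
-/

/-! ### Sums over the entries of a list -/

lemma List.sum_map_modify {E : Type*} [AddCommGroup E] (g : ℕ → E) (f : ℕ → ℕ) (l : List ℕ)
    {i : ℕ} (h : i < l.length) :
    ((l.modify i f).map g).sum
      = (l.map g).sum + (g (f (l.getD i 0)) - g (l.getD i 0)) := by
  induction l generalizing i with
  | nil => simp at h
  | cons a l ih =>
    cases i with
    | zero => simp only [List.modify_zero_cons, List.map_cons, List.sum_cons, List.getD_cons_zero]; abel
    | succ i =>
      have := ih (i := i) (by simpa using h)
      simp only [List.modify_succ_cons, List.map_cons, List.sum_cons, List.getD_cons_succ, this]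
      abel

lemma List.sum_range_map_getD {E : Type*} [AddCommMonoid E] (g : ℕ → E) (l : List ℕ) :
    ∑ i ∈ Finset.range l.length, g (l.getD i 0) = (l.map g).sum := by
  induction l with
  | nil => simp
  | cons a l ih =>
    rw [List.length_cons, Finset.sum_range_succ']
    simp only [List.getD_cons_succ, List.getD_cons_zero, ih, List.map_cons, List.sum_cons]
    exact add_comm _ _

/-! ### The law of the chain -/

namespace DegSeq

instance : Countable DegSeq := inferInstanceAs (Countable {x : List ℕ // x ≠ []})

instance : DiscreteMeasurableSpace DegSeq := ⟨fun _ => trivial⟩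

/-- The one-step mean of a function `F` of the state: the expectation of `F` after one transition
of the chain started at `x`. -/
noncomputable def stepMean (l1 l2 m2 : ℝ) (F : List ℕ → ℝ) (x : List ℕ) : ℝ :=
  ((∑ i ∈ Finset.range x.length, (x.getD i 0 : ℝ) * l2 * F (x.modify i (fun k => k + 1)))
    + (∑ i ∈ Finset.range x.length, (x.getD i 0 : ℝ) * m2 * F (x.modify i (fun k => k - 1)))
    + (x.length : ℝ) * l1 * F (x ++ [1]))
  / ((l2 + m2) * (x.sum : ℝ) + (x.length : ℝ) * l1)

lemma length_pos (x : DegSeq) : 0 < x.1.length := List.length_pos_iff.2 x.2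

lemma rate_pos {l1 l2 m2 : ℝ} (hl1 : 0 < l1) (hl2 : 0 < l2) (hm2 : 0 ≤ m2) (x : DegSeq) :
    0 < (l2 + m2) * (x.1.sum : ℝ) + (x.1.length : ℝ) * l1 := by
  have : (0 : ℝ) < x.1.length := by exact_mod_cast x.length_pos
  positivity

lemma trans_nonneg {l1 l2 m2 : ℝ} (hl1 : 0 < l1) (hl2 : 0 < l2) (hm2 : 0 ≤ m2) (x y : DegSeq) :
    0 ≤ trans l1 l2 m2 x y := by
  unfold trans
  refine div_nonneg (add_nonneg (add_nonneg (Finset.sum_nonneg fun i _ => ?_)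
    (Finset.sum_nonneg fun i _ => ?_)) ?_) (rate_pos hl1 hl2 hm2 x).le
  all_goals split_ifs <;> positivity

lemma hasSum_trans_mul (l1 l2 m2 : ℝ) (F : List ℕ → ℝ) (x : DegSeq) :
    HasSum (fun y : DegSeq => trans l1 l2 m2 x y * F y.1) (stepMean l1 l2 m2 F x.1) := by
  classical
  have key : ∀ (z : List ℕ) (_ : z ≠ []) (a : ℝ),
      HasSum (fun y : DegSeq => (if y.1 = z then a else 0) * F y.1) (a * F z) := by
    intro z hz a
    have h := hasSum_ite_eq (⟨z, hz⟩ : DegSeq) (a * F z)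
    refine h.congr_fun fun y => ?_
    by_cases hy : y = ⟨z, hz⟩
    · subst hy; simp
    · have : y.1 ≠ z := fun h => hy (Subtype.ext h)
      simp [this, hy]
  have h1 := hasSum_sum (s := Finset.range x.len) fun i _ =>
    key (x.1.modify i (fun k => k + 1)) (by simpa using x.2) ((x.entry i : ℝ) * l2)
  have h2 := hasSum_sum (s := Finset.range x.len) fun i _ =>
    key (x.1.modify i (fun k => k - 1)) (by simpa using x.2) ((x.entry i : ℝ) * m2)
  have h3 := key (x.1 ++ [1]) (by simp) ((x.len : ℝ) * l1)
  refine (((h1.add h2).add h3).div_const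
    ((l2 + m2) * (x.total : ℝ) + (x.len : ℝ) * l1)).congr_fun fun y => ?_
  simp only [trans, ← Finset.sum_mul, ← add_mul]
  rw [div_mul_eq_mul_div]

/-- A transition with positive probability adds at most two to `ℓ(x) + ‖x‖`; two is
attained when an entry is appended. -/
lemma sum_add_length_le_of_trans_ne_zero {l1 l2 m2 : ℝ} {x y : DegSeq}
    (h : trans l1 l2 m2 x y ≠ 0) : y.1.sum + y.1.length ≤ x.1.sum + x.1.length + 2 := by
  contrapose! h
  have hmod : ∀ (f : ℕ → ℕ), (∀ k, f k ≤ k + 1) → ∀ i, y.1 = x.1.modify i f → False := by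
    intro f hf i hy
    by_cases hi : i < x.1.length
    · have h1 := List.sum_map_modify (fun k : ℕ => (k : ℤ)) f x.1 hi
      have h2 := hf (x.1.getD i 0)
      have h3 : ((x.1.modify i f).map (fun k : ℕ => (k : ℤ))).sum = (y.1.sum : ℤ) := by
        rw [hy, Nat.cast_list_sum]
      have h4 : (x.1.map (fun k : ℕ => (k : ℤ))).sum = (x.1.sum : ℤ) := by
        rw [Nat.cast_list_sum]
      have h5 : y.1.length = x.1.length := by rw [hy]; simp
      rw [h3, h4] at h1
      omega
    · rw [List.modify_eq_self (by omega)] at hy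
      rw [hy] at h; omega
  unfold trans
  rw [Finset.sum_eq_zero, Finset.sum_eq_zero, if_neg]
  · simp
  · intro hy
    rw [hy] at h
    simp at h
    omega
  · intro i _
    exact if_neg fun hy => hmod _ (fun k => by omega) i hy
  · intro i _
    exact if_neg fun hy => hmod _ (fun k => by omega) i hy

end DegSeq

namespace IsInDegreeChain

open DegSeq

variable {Ω : Type*} [MeasurableSpace Ω] {P : Measure Ω} {l1 l2 m2 : ℝ} {d : ℕ → Ω → DegSeq}

lemma lintegral_eq_tsum (hd : IsInDegreeChain l1 l2 m2 P d) (t : ℕ) (f : DegSeq → ENNReal) :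
    ∫⁻ ω, f (d t ω) ∂P = ∑' x, f x * P {ω | d t ω = x} := by
  rw [← lintegral_map (μ := P) (measurable_of_countable f) (hd.measurable t), lintegral_countable']
  refine tsum_congr fun x => ?_
  rw [Measure.map_apply (hd.measurable t) (measurableSet_singleton x)]
  rfl

variable [IsProbabilityMeasure P]

/-- The Markov property for one step, with the history summed out. -/
lemma measure_pair (hd : IsInDegreeChain l1 l2 m2 P d) (t : ℕ) (x y : DegSeq) :
    P {ω | d t ω = x ∧ d (t + 1) ω = y}
      = P {ω | d t ω = x} * ENNReal.ofReal (trans l1 l2 m2 x y) := by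
  classical
  let X : Ω → (Fin (t + 1) → DegSeq) := fun ω s => d s ω
  have hX : Measurable X := measurable_pi_lambda _ fun s => hd.measurable s
  let ext : (Fin (t + 1) → DegSeq) → ℕ → DegSeq := fun h s =>
    if hs : s < t + 1 then h ⟨s, hs⟩ else DegSeq.one
  have hext : ∀ (h : Fin (t + 1) → DegSeq) ω, (∀ s ≤ t, d s ω = ext h s) ↔ X ω = h := by
    intro h ω
    constructor
    · intro H
      funext s
      have := H s (by omega)
      simpa only [ext, X, s.2, dif_pos] using this
    · rintro rfl s hs
      have hs' : s < t + 1 := by omega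
      simp only [ext, X, hs', dif_pos]
  have hsplit : ∀ B : Set Ω, P B = ∑' h, P (X ⁻¹' {h} ∩ B) := by
    intro B
    have h1 := tsum_measure_preimage_singleton (μ := P.restrict B) (f := X) (s := Set.univ)
      Set.countable_univ (fun h _ => hX (measurableSet_singleton h))
    rw [Set.preimage_univ, Measure.restrict_apply_univ] at h1
    rw [← h1, tsum_univ (fun h => P.restrict B (X ⁻¹' {h}))]
    exact tsum_congr fun h => Measure.restrict_apply (hX (measurableSet_singleton h))
  rw [hsplit {ω | d t ω = x ∧ d (t + 1) ω = y}, hsplit {ω | d t ω = x}, ← ENNReal.tsum_mul_right]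
  refine tsum_congr fun h => ?_
  have hlast : ∀ ω, X ω = h → d t ω = h (Fin.last t) := by
    rintro ω rfl; rfl
  by_cases hx : h (Fin.last t) = x
  · have e1 : X ⁻¹' {h} ∩ {ω | d t ω = x ∧ d (t + 1) ω = y}
        = {ω | (∀ s ≤ t, d s ω = ext h s) ∧ d (t + 1) ω = y} := by
      ext ω
      simp only [Set.mem_inter_iff, Set.mem_preimage, Set.mem_singleton_iff, Set.mem_ofPred_eq,
        hext]
      exact ⟨fun H => ⟨H.1, H.2.2⟩, fun H => ⟨H.1, (hlast ω H.1).trans hx, H.2⟩⟩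
    have e2 : X ⁻¹' {h} ∩ {ω | d t ω = x} = {ω | ∀ s ≤ t, d s ω = ext h s} := by
      ext ω
      simp only [Set.mem_inter_iff, Set.mem_preimage, Set.mem_singleton_iff, Set.mem_ofPred_eq,
        hext]
      exact ⟨fun H => H.1, fun H => ⟨H, (hlast ω H).trans hx⟩⟩
    have e3 : ext h t = x := by
      rw [← hx]; simp [ext, Fin.last]
    have := hd.step t (ext h) y
    rw [e3] at this
    rw [e1, e2, ← ENNReal.ofReal_toReal (measure_ne_top P {ω | ∀ s ≤ t, d s ω = ext h s}),
      ← ENNReal.ofReal_mul ENNReal.toReal_nonneg]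
    change _ = ENNReal.ofReal (P.real _ * _)
    rw [← this]
    exact (ENNReal.ofReal_toReal (measure_ne_top _ _)).symm
  · have e1 : X ⁻¹' {h} ∩ {ω | d t ω = x} = ∅ := by
      ext ω
      simp only [Set.mem_inter_iff, Set.mem_preimage, Set.mem_singleton_iff, Set.mem_ofPred_eq,
        Set.mem_empty_iff_false, iff_false, not_and]
      exact fun H1 H2 => hx ((hlast ω H1).symm.trans H2)
    have e2 : X ⁻¹' {h} ∩ {ω | d t ω = x ∧ d (t + 1) ω = y} = ∅ := by
      rw [Set.eq_empty_iff_forall_notMem] at e1 ⊢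
      exact fun ω H => e1 ω ⟨H.1, H.2.1⟩
    rw [e1, e2]; simp

lemma measure_succ (hd : IsInDegreeChain l1 l2 m2 P d) (t : ℕ) (y : DegSeq) :
    P {ω | d (t + 1) ω = y}
      = ∑' x, P {ω | d t ω = x} * ENNReal.ofReal (trans l1 l2 m2 x y) := by
  have h1 := tsum_measure_preimage_singleton (μ := P.restrict {ω | d (t + 1) ω = y})
    (f := d t) (s := Set.univ) Set.countable_univ
    (fun h _ => hd.measurable t (measurableSet_singleton h))
  rw [Set.preimage_univ, Measure.restrict_apply_univ] at h1
  rw [← h1, tsum_univ (fun h => P.restrict {ω | d (t + 1) ω = y} (d t ⁻¹' {h}))]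
  refine tsum_congr fun x => ?_
  rw [Measure.restrict_apply (hd.measurable t (measurableSet_singleton x)),
    ← hd.measure_pair]
  rfl

/-- Comparison of expectations at consecutive times, from a pointwise bound on the one-step mean
at the states that are visited with positive probability. -/
lemma lintegral_succ_le (hl1 : 0 < l1) (hl2 : 0 < l2) (hm2 : 0 ≤ m2)
    (hd : IsInDegreeChain l1 l2 m2 P d) (t : ℕ) {F G : List ℕ → ℝ} (hF : ∀ x, 0 ≤ F x)
    (hFG : ∀ x : DegSeq, P {ω | d t ω = x} ≠ 0 → stepMean l1 l2 m2 F x.1 ≤ G x.1) :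
    ∫⁻ ω, ENNReal.ofReal (F (d (t + 1) ω).1) ∂P ≤ ∫⁻ ω, ENNReal.ofReal (G (d t ω).1) ∂P := by
  rw [hd.lintegral_eq_tsum (t + 1) (fun x => ENNReal.ofReal (F x.1)),
    hd.lintegral_eq_tsum t (fun x => ENNReal.ofReal (G x.1))]
  have h1 : ∀ y : DegSeq, ENNReal.ofReal (F y.1) * P {ω | d (t + 1) ω = y}
      = ∑' x, P {ω | d t ω = x} * ENNReal.ofReal (trans l1 l2 m2 x y * F y.1) := by
    intro y
    rw [hd.measure_succ, ← ENNReal.tsum_mul_left]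
    refine tsum_congr fun x => ?_
    rw [ENNReal.ofReal_mul (trans_nonneg hl1 hl2 hm2 x y)]
    ring
  simp_rw [h1]
  rw [ENNReal.tsum_comm]
  refine ENNReal.tsum_le_tsum fun x => ?_
  rw [ENNReal.tsum_mul_left]
  have h2 := hasSum_trans_mul l1 l2 m2 F x
  rw [← ENNReal.ofReal_tsum_of_nonneg
    (fun y => mul_nonneg (trans_nonneg hl1 hl2 hm2 x y) (hF y.1)) h2.summable, h2.tsum_eq, mul_comm]
  by_cases hx : P {ω | d t ω = x} = 0
  · simp [hx]
  · gcongr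
    exact hFG x hx

lemma ae_init (hd : IsInDegreeChain l1 l2 m2 P d) : ∀ᵐ ω ∂P, d 0 ω = DegSeq.one := by
  have hm : MeasurableSet {ω | d 0 ω = DegSeq.one} :=
    hd.measurable 0 (measurableSet_singleton DegSeq.one)
  rw [ae_iff]
  have h : P {ω | d 0 ω = DegSeq.one} = 1 := by
    rw [← ENNReal.toReal_eq_one_iff]; exact hd.init
  exact (prob_compl_eq_zero_iff hm).2 h

lemma lintegral_zero (hd : IsInDegreeChain l1 l2 m2 P d) (F : List ℕ → ℝ) :
    ∫⁻ ω, ENNReal.ofReal (F (d 0 ω).1) ∂P = ENNReal.ofReal (F [1]) := by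
  rw [lintegral_congr_ae (g := fun _ => ENNReal.ofReal (F [1]))]
  · simp
  · filter_upwards [hd.ae_init] with ω hω
    rw [hω]; rfl

/-- After `t` steps the states that are visited satisfy `‖x‖ + ℓ(x) ≤ 2 (t + 1)`. -/
lemma sum_add_length_le (hd : IsInDegreeChain l1 l2 m2 P d) (t : ℕ) :
    ∀ x : DegSeq, P {ω | d t ω = x} ≠ 0 → x.1.sum + x.1.length ≤ 2 * (t + 1) := by
  induction t with
  | zero =>
    intro x hx
    by_cases h : x = DegSeq.one
    · subst h; simp [DegSeq.one]
    · refine absurd (measure_mono_null ?_ (ae_iff.1 hd.ae_init)) hx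
      rintro ω rfl
      exact h
  | succ t ih =>
    intro y hy
    rw [hd.measure_succ, ne_eq, ENNReal.tsum_eq_zero, not_forall] at hy
    obtain ⟨x, hx⟩ := hy
    have h1 := ih x (left_ne_zero_of_mul hx)
    have h2 : trans l1 l2 m2 x y ≠ 0 := by
      intro h; simp [h] at hx
    have := sum_add_length_le_of_trans_ne_zero h2
    omega

end IsInDegreeChain

/-- The law of the degree of a uniform vertex is the mean of the empirical degree distribution. -/
lemma IsUniformVertexDegree.real_eq_integral {Ω : Type*} [MeasurableSpace Ω] {P : Measure Ω}
    [IsProbabilityMeasure P] {d : ℕ → Ω → DegSeq} {D : ℕ → Ω → ℕ}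
    (hD : IsUniformVertexDegree P d D) (hd : ∀ t, Measurable (d t)) (t j : ℕ) :
    P.real {ω | D t ω = j}
      = ∫ ω, ((d t ω).1.map (fun k => if k = j then (1 : ℝ) else 0)).sum
          / ((d t ω).1.length : ℝ) ∂P := by
  classical
  have hlen : Measurable fun ω => (d t ω).len := (measurable_of_countable DegSeq.len).comp (hd t)
  have hA : ∀ n, MeasurableSet {ω | (d t ω).len = n} := fun n => hlen (measurableSet_singleton n)
  have hfm : Measurable fun x : DegSeq =>
      (x.1.map (fun k => if k = j then (1 : ℝ) else 0)).sum / (x.1.length : ℝ) :=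
    measurable_of_countable _
  have hf0 : ∀ x : DegSeq,
      0 ≤ (x.1.map (fun k => if k = j then (1 : ℝ) else 0)).sum / (x.1.length : ℝ) := by
    intro x
    refine div_nonneg (List.sum_nonneg ?_) (Nat.cast_nonneg _)
    intro a ha
    obtain ⟨k, -, rfl⟩ := List.mem_map.1 ha
    split_ifs <;> norm_num
  rw [integral_eq_lintegral_of_nonneg_ae (Eventually.of_forall fun ω => hf0 (d t ω))
    (hfm.comp (hd t)).aestronglyMeasurable]
  unfold Measure.real
  congr 1
  have hsplit : ∀ f : Ω → ENNReal,
      ∫⁻ ω, f ω ∂P = ∑' n, ∫⁻ ω in {ω | (d t ω).len = n}, f ω ∂P := by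
    intro f
    rw [← lintegral_iUnion hA]
    · rw [show (⋃ n, {ω | (d t ω).len = n}) = Set.univ by ext ω; simp, Measure.restrict_univ]
    · intro m n hmn
      refine Set.disjoint_left.2 fun ω h1 h2 => hmn ?_
      exact h1.symm.trans h2
  have hE : MeasurableSet {ω | D t ω = j} := hD.measurable t (measurableSet_singleton j)
  rw [← lintegral_indicator_one hE, hsplit, hsplit]
  refine tsum_congr fun n => ?_
  rw [lintegral_indicator_one hE, Measure.restrict_apply hE]
  rcases Nat.eq_zero_or_pos n with rfl | hn
  · have : {ω | (d t ω).len = 0} = ∅ := by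
      ext ω; simpa using (show ¬ (d t ω).len = 0 from (d t ω).length_pos.ne')
    simp [this]
  have hB : ∀ i, MeasurableSet {ω | (d t ω).entry i = j} := fun i =>
    ((measurable_of_countable fun x : DegSeq => x.entry i).comp (hd t)) (measurableSet_singleton j)
  have hn0 : (0 : ℝ) < n := by exact_mod_cast hn
  have hcond : ∀ B : Set Ω, (P[|{ω | (d t ω).len = n}]).real B
      = (P.real {ω | (d t ω).len = n})⁻¹ * P.real ({ω | (d t ω).len = n} ∩ B) := fun B => by
    simp only [Measure.real, cond_apply (hA n), ENNReal.toReal_mul, ENNReal.toReal_inv]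
  have hmain : P.real ({ω | (d t ω).len = n} ∩ {ω | D t ω = j})
      = (1 / (n : ℝ)) * ∑ i ∈ Finset.range n,
          P.real ({ω | (d t ω).len = n} ∩ {ω | (d t ω).entry i = j}) := by
    by_cases h0 : P.real {ω | (d t ω).len = n} = 0
    · have hz : ∀ B : Set Ω, P.real ({ω | (d t ω).len = n} ∩ B) = 0 := fun B =>
        le_antisymm ((measureReal_mono Set.inter_subset_left).trans h0.le) measureReal_nonneg
      simp [hz]
    · have h := hD.cond_eq t n j hn
      simp_rw [hcond] at h
      rw [← Finset.mul_sum] at h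
      field_simp at h ⊢
      exact h
  have hrhs : ∫⁻ ω in {ω | (d t ω).len = n}, ENNReal.ofReal
        (((d t ω).1.map (fun k => if k = j then (1 : ℝ) else 0)).sum / ((d t ω).1.length : ℝ)) ∂P
      = ENNReal.ofReal (1 / (n : ℝ)) * ∑ i ∈ Finset.range n,
          P ({ω | (d t ω).len = n} ∩ {ω | (d t ω).entry i = j}) := by
    have e1 : ∀ ω ∈ {ω | (d t ω).len = n}, ENNReal.ofReal
        (((d t ω).1.map (fun k => if k = j then (1 : ℝ) else 0)).sum / ((d t ω).1.length : ℝ))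
        = ENNReal.ofReal (1 / (n : ℝ)) * ∑ i ∈ Finset.range n,
          Set.indicator {ω | (d t ω).entry i = j} 1 ω := by
      intro ω hω
      have hω' : (d t ω).1.length = n := hω
      rw [← List.sum_range_map_getD, hω', div_eq_mul_one_div, mul_comm,
        ENNReal.ofReal_mul (by positivity), ENNReal.ofReal_sum_of_nonneg]
      · congr 1
        refine Finset.sum_congr rfl fun i _ => ?_
        by_cases hi : (d t ω).1.getD i 0 = j
        · rw [if_pos hi, Set.indicator_of_mem (by exact hi)]; simp
        · rw [if_neg hi, Set.indicator_of_notMem (by exact hi)]; simp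
      · intro i _; split_ifs <;> norm_num
    rw [setLIntegral_congr_fun (hA n) e1, lintegral_const_mul, lintegral_finsetSum]
    · congr 1
      refine Finset.sum_congr rfl fun i _ => ?_
      rw [lintegral_indicator_one (hB i), Measure.restrict_apply (hB i), Set.inter_comm]
    · exact fun i _ => measurable_one.indicator (hB i)
    · exact Finset.measurable_fun_sum _ fun i _ => measurable_one.indicator (hB i)
  rw [hrhs, Set.inter_comm, ← ENNReal.ofReal_toReal (measure_ne_top P
    ({ω | (d t ω).len = n} ∩ {ω | D t ω = j}))]
  change ENNReal.ofReal (P.real _) = _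
  rw [hmain, ENNReal.ofReal_mul (by positivity),
    ENNReal.ofReal_sum_of_nonneg fun i _ => measureReal_nonneg]
  congr 1
  exact Finset.sum_congr rfl fun i _ => ENNReal.ofReal_toReal (measure_ne_top _ _)

/-! ### Generators -/

/-- The generator of the linear birth-death process with birth rate `l2` and death rate `m2` per
unit of degree, which is the evolution of a single degree. -/
noncomputable def degGen {E : Type*} [AddCommGroup E] [Module ℝ E] (l2 m2 : ℝ) (f : ℕ → E)
    (k : ℕ) : E :=
  ((k : ℝ) * l2) • (f (k + 1) - f k) + ((k : ℝ) * m2) • (f (k - 1) - f k)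

/-- The rate at which the function `f` of a single degree gains quadratic variation. -/
noncomputable def quadVar {E : Type*} [NormedAddCommGroup E] (l2 m2 : ℝ) (f : ℕ → E) (k : ℕ) : ℝ :=
  (k : ℝ) * l2 * ‖f (k + 1) - f k‖ ^ 2 + (k : ℝ) * m2 * ‖f (k - 1) - f k‖ ^ 2

lemma List.sum_map_sub_const {E : Type*} [AddCommGroup E] [Module ℝ E] (φ : ℕ → E) (c : E)
    (x : List ℕ) :
    (x.map (fun k => φ k - c)).sum = (x.map φ).sum - (x.length : ℝ) • c := by
  induction x with
  | nil => simp
  | cons b l ih =>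
    simp only [List.map_cons, List.sum_cons, List.length_cons, Nat.cast_add_one, add_smul,
      one_smul, ih]
    abel

namespace DegSeq

/-- The generator of the chain on degree sequences in continuous time, where each transition
occurs at the rate given by its unnormalised weight. -/
noncomputable def seqGen (l1 l2 m2 : ℝ) (F : List ℕ → ℝ) (x : List ℕ) : ℝ :=
  (∑ i ∈ Finset.range x.length,
      (x.getD i 0 : ℝ) * l2 * (F (x.modify i (fun k => k + 1)) - F x))
    + (∑ i ∈ Finset.range x.length,
      (x.getD i 0 : ℝ) * m2 * (F (x.modify i (fun k => k - 1)) - F x))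
    + (x.length : ℝ) * l1 * (F (x ++ [1]) - F x)

lemma stepMean_eq {l1 l2 m2 : ℝ} (hl1 : 0 < l1) (hl2 : 0 < l2) (hm2 : 0 ≤ m2) (F : List ℕ → ℝ)
    (x : DegSeq) :
    stepMean l1 l2 m2 F x.1
      = F x.1 + seqGen l1 l2 m2 F x.1 / ((l2 + m2) * (x.1.sum : ℝ) + (x.1.length : ℝ) * l1) := by
  have hN := rate_pos hl1 hl2 hm2 x
  rw [stepMean, div_eq_iff hN.ne', add_mul, div_mul_cancel₀ _ hN.ne', seqGen]
  have h : (x.1.sum : ℝ) = ∑ i ∈ Finset.range x.1.length, (x.1.getD i 0 : ℝ) := by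
    rw [List.sum_range_map_getD (fun k => (k : ℝ)), Nat.cast_list_sum]
  simp only [mul_sub, Finset.sum_sub_distrib, ← Finset.sum_mul]
  rw [h]
  ring

lemma seqGen_add (l1 l2 m2 : ℝ) (F G : List ℕ → ℝ) (x : List ℕ) :
    seqGen l1 l2 m2 (fun z => F z + G z) x = seqGen l1 l2 m2 F x + seqGen l1 l2 m2 G x := by
  have h : ∀ a b c d e : ℝ, a * (b + c - (d + e)) = a * (b - d) + a * (c - e) := by
    intros; ring
  simp only [seqGen, h, Finset.sum_add_distrib]
  ring

lemma seqGen_const_mul (l1 l2 m2 C : ℝ) (F : List ℕ → ℝ) (x : List ℕ) :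
    seqGen l1 l2 m2 (fun z => C * F z) x = C * seqGen l1 l2 m2 F x := by
  have h : ∀ a b d : ℝ, a * (C * b - C * d) = C * (a * (b - d)) := by
    intros; ring
  simp only [seqGen, h, ← Finset.mul_sum]
  ring

lemma seqGen_length (l1 l2 m2 : ℝ) (h : ℕ → ℝ) (x : List ℕ) :
    seqGen l1 l2 m2 (fun z => h z.length) x
      = -((x.length : ℝ) * l1 * (h x.length - h (x.length + 1))) := by
  simp only [seqGen, List.length_modify, sub_self, mul_zero, Finset.sum_const_zero,
    List.length_append, List.length_singleton]
  ring

lemma seqGen_sum_mul (l1 l2 m2 : ℝ) (ρ : ℕ → ℝ) (h : ℕ → ℝ) (x : List ℕ) :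
    seqGen l1 l2 m2 (fun z => (z.map ρ).sum * h z.length) x
      = h x.length * (x.map (degGen l2 m2 ρ)).sum
        + (x.length : ℝ) * l1 * (ρ 1 * h (x.length + 1)
          - (x.map ρ).sum * (h x.length - h (x.length + 1))) := by
  rw [seqGen, ← Finset.sum_add_distrib, ← List.sum_range_map_getD (degGen l2 m2 ρ), Finset.mul_sum]
  congr 1
  · refine Finset.sum_congr rfl fun i hi => ?_
    have hi' := Finset.mem_range.1 hi
    rw [List.sum_map_modify ρ _ x hi', List.sum_map_modify ρ _ x hi']
    simp only [List.length_modify, degGen, smul_eq_mul]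
    ring
  · simp only [List.map_append, List.sum_append, List.length_append, List.map_cons, List.map_nil,
      List.sum_singleton, List.length_singleton]
    ring

lemma seqGen_norm_sq_mul {H : Type*} [NormedAddCommGroup H] [InnerProductSpace ℝ H]
    (l1 l2 m2 : ℝ) (φ : ℕ → H) (c : H) (h : ℕ → ℝ) (x : List ℕ) :
    seqGen l1 l2 m2 (fun z => ‖(z.map (fun k => φ k - c)).sum‖ ^ 2 * h z.length) x
      = h x.length * (2 * inner ℝ (x.map (fun k => φ k - c)).sum
            ((x.map (degGen l2 m2 φ)).sum + ((x.length : ℝ) * l1) • (φ 1 - c))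
          + (x.map (quadVar l2 m2 φ)).sum
          + (x.length : ℝ) * l1 * ‖φ 1 - c‖ ^ 2)
        - (x.length : ℝ) * l1 * (h x.length - h (x.length + 1))
          * ‖(x.map (fun k => φ k - c)).sum + (φ 1 - c)‖ ^ 2 := by
  set Y := (x.map (fun k => φ k - c)).sum with hY
  have e1 : (x.map (quadVar l2 m2 φ)).sum = _ :=
    (List.sum_range_map_getD _ x).symm
  have e2 : ∀ i ∈ Finset.range x.length,
      (x.getD i 0 : ℝ) * l2 * (‖((x.modify i (fun k => k + 1)).map (fun k => φ k - c)).sum‖ ^ 2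
          * h (x.modify i (fun k => k + 1)).length - ‖Y‖ ^ 2 * h x.length)
      + (x.getD i 0 : ℝ) * m2 * (‖((x.modify i (fun k => k - 1)).map (fun k => φ k - c)).sum‖ ^ 2
          * h (x.modify i (fun k => k - 1)).length - ‖Y‖ ^ 2 * h x.length)
      = h x.length * (2 * inner ℝ Y (degGen l2 m2 φ (x.getD i 0))
          + quadVar l2 m2 φ (x.getD i 0)) := by
    intro i hi
    have hi' := Finset.mem_range.1 hi
    rw [List.sum_map_modify _ _ x hi', List.sum_map_modify _ _ x hi', ← hY]
    simp only [List.length_modify, degGen, quadVar, sub_sub_sub_cancel_right, norm_add_sq_real,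
      inner_add_right, inner_smul_right]
    ring
  rw [seqGen, ← Finset.sum_add_distrib, Finset.sum_congr rfl e2, ← Finset.mul_sum,
    Finset.sum_add_distrib, ← Finset.mul_sum, ← inner_sum, List.sum_range_map_getD (degGen l2 m2 φ),
    e1]
  simp only [List.map_append, List.sum_append, List.length_append, List.map_cons, List.map_nil,
      List.sum_singleton, List.length_singleton, ← hY, inner_add_right, inner_smul_right,
      norm_add_sq_real]
  ring

end DegSeq

/-! ### Hilbert space valued statistics -/

/-- A Hilbert space valued statistic `φ` of a degree that is adapted to the weights `p`:
`φ` satisfies a dissipativity estimate for the birth-death generator, `c` is the mean of `φ`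
under `p`, and `p` is stationary for the evolution in which degrees follow the birth-death process
and new vertices of degree one dilute the population at rate `l1`. The function `ρ` is
superharmonic and controls the quadratic variation of `φ`. -/
structure IsDegreeStatistic {H : Type*} [NormedAddCommGroup H] [InnerProductSpace ℝ H]
    (l1 l2 m2 : ℝ) (p : ℕ → ℝ) (φ : ℕ → H) (c : H) (ρ : ℕ → ℝ) (C : ℝ) : Prop where
  dissipative : ∀ a : ℕ →₀ ℝ,
    inner ℝ (Finsupp.linearCombination ℝ φ a) (Finsupp.linearCombination ℝ (degGen l2 m2 φ) a)
      ≤ l1 / 8 * ‖Finsupp.linearCombination ℝ φ a‖ ^ 2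
  hasSum_mean : HasSum (fun k => p k • φ k) c
  hasSum_gen : HasSum (fun k => p k • degGen l2 m2 φ k) (l1 • (c - φ 1))
  rho_nonneg : ∀ k, 0 ≤ ρ k
  gen_rho_nonpos : ∀ k, degGen l2 m2 ρ k ≤ 0
  C_nonneg : 0 ≤ C
  quad_le : ∀ k, quadVar l2 m2 φ k ≤ C * (1 + ρ k)

/-- The weight `n ^ (-3/2)`. -/
noncomputable def sqrtDecay (n : ℕ) : ℝ := 1 / ((n : ℝ) * √n)

lemma sqrtDecay_pos {n : ℕ} (hn : 1 ≤ n) : 0 < sqrtDecay n := by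
  have : (0 : ℝ) < n := by exact_mod_cast hn
  unfold sqrtDecay; positivity

lemma sqrtDecay_nonneg (n : ℕ) : 0 ≤ sqrtDecay n := by
  unfold sqrtDecay; positivity

lemma half_sqrtDecay_le {n : ℕ} (hn : 1 ≤ n) :
    sqrtDecay n / 2 ≤ (n : ℝ) * (sqrtDecay n - sqrtDecay (n + 1)) := by
  have hn' : (1 : ℝ) ≤ n := by exact_mod_cast hn
  have h1 : sqrtDecay (n + 1) ≤ (n / (n + 1)) * sqrtDecay n := by
    unfold sqrtDecay
    rw [div_mul_div_comm, Nat.cast_add_one, div_le_div_iff₀ (by positivity) (by positivity)]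
    have : √(n : ℝ) ≤ √((n : ℝ) + 1) := Real.sqrt_le_sqrt (by linarith)
    have h2 : 0 ≤ (n : ℝ) * (n + 1) := by positivity
    nlinarith [mul_le_mul_of_nonneg_left this h2]
  have h2 : (1 / 2 : ℝ) ≤ n * (1 - n / (n + 1)) := by
    have : (n : ℝ) * (1 - n / (n + 1)) = n / (n + 1) := by field_simp; ring
    rw [this, div_le_div_iff₀ (by norm_num) (by positivity)]
    linarith
  nlinarith [sqrtDecay_pos hn, mul_le_mul_of_nonneg_right h2 (sqrtDecay_pos hn).le,
    mul_le_mul_of_nonneg_left h1 (show (0 : ℝ) ≤ n by linarith)]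

lemma sqrtDecay_le_sub {n : ℕ} (hn : 1 ≤ n) :
    sqrtDecay n / 8 ≤ 1 / √(n : ℝ) - 1 / √((n + 1 : ℕ) : ℝ) := by
  have hn' : (1 : ℝ) ≤ n := by exact_mod_cast hn
  have ha : 0 < √(n : ℝ) := Real.sqrt_pos.2 (by linarith)
  have hb : 0 < √((n : ℝ) + 1) := Real.sqrt_pos.2 (by linarith)
  have ha2 : √(n : ℝ) ^ 2 = n := Real.sq_sqrt (by linarith)
  have hb2 : √((n : ℝ) + 1) ^ 2 = n + 1 := Real.sq_sqrt (by linarith)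
  unfold sqrtDecay
  rw [Nat.cast_add_one]
  generalize √((n : ℝ) + 1) = b at *
  generalize √(n : ℝ) = a at *
  rw [← ha2]
  have hba : b ≤ 2 * a := by nlinarith
  have e : 1 / a - 1 / b = 1 / (a * b * (a + b)) := by
    rw [div_sub_div _ _ ha.ne' hb.ne', div_eq_div_iff (by positivity) (by positivity)]
    have : (b - a) * (a + b) = 1 := by nlinarith
    linear_combination (a * b) * this
  rw [e, div_div, div_le_div_iff₀ (by positivity) (by positivity)]
  have h1 : b * (a + b) ≤ (2 * a) * (3 * a) := by gcongr; linarith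
  nlinarith [mul_le_mul_of_nonneg_left h1 ha.le, pow_pos ha 3]

namespace IsDegreeStatistic

variable {H : Type*} [NormedAddCommGroup H] [InnerProductSpace ℝ H] {l1 l2 m2 : ℝ} {p : ℕ → ℝ}
  {φ : ℕ → H} {c : H} {ρ : ℕ → ℝ} {C : ℝ}

/-- The drift of the centred sum of `φ` is dissipative: this follows from the finitely supported
case by truncating `p`. -/
lemma inner_drift_le (hφ : IsDegreeStatistic l1 l2 m2 p φ c ρ C) (x : List ℕ) :
    inner ℝ (x.map (fun k => φ k - c)).sum
        ((x.map (degGen l2 m2 φ)).sum + ((x.length : ℝ) * l1) • (φ 1 - c))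
      ≤ l1 / 8 * ‖(x.map (fun k => φ k - c)).sum‖ ^ 2 := by
  let a : ℕ → ℕ →₀ ℝ := fun M => (x.map (fun k => Finsupp.single k (1 : ℝ))).sum
    - (x.length : ℝ) • ∑ k ∈ Finset.range M, Finsupp.single k (p k)
  have ha : ∀ (g : ℕ → H) M, Finsupp.linearCombination ℝ g (a M)
      = (x.map g).sum - (x.length : ℝ) • ∑ k ∈ Finset.range M, p k • g k := by
    intro g M
    simp only [a, map_sub, map_smul, map_sum, Finsupp.linearCombination_single, map_list_sum,
      List.map_map]
    congr 3
    funext k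
    simp
  have t1 : Tendsto (fun M => Finsupp.linearCombination ℝ φ (a M)) atTop
      (𝓝 (x.map (fun k => φ k - c)).sum) := by
    simp only [ha, List.sum_map_sub_const]
    exact tendsto_const_nhds.sub (hφ.hasSum_mean.tendsto_sum_nat.const_smul _)
  have t2 : Tendsto (fun M => Finsupp.linearCombination ℝ (degGen l2 m2 φ) (a M)) atTop
      (𝓝 ((x.map (degGen l2 m2 φ)).sum + ((x.length : ℝ) * l1) • (φ 1 - c))) := by
    simp only [ha]
    have := tendsto_const_nhds (x := (x.map (degGen l2 m2 φ)).sum) (f := atTop (α := ℕ))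
      |>.sub (hφ.hasSum_gen.tendsto_sum_nat.const_smul (x.length : ℝ))
    convert this using 2
    rw [smul_smul, ← neg_sub c, smul_neg]
    abel
  exact le_of_tendsto_of_tendsto' (t1.inner t2) ((t1.norm.pow 2).const_mul (l1 / 8))
    fun M => hφ.dissipative (a M)

/-- The squared norm of the centred sum of `φ`, weighted by `n ^ (-3/2)`, becomes a supermartingale
after adding multiples of the sum of `ρ` and of `n ^ (-1/2)`. -/
lemma exists_seqGen_nonpos (hl1 : 0 < l1) (hφ : IsDegreeStatistic l1 l2 m2 p φ c ρ C) :
    ∃ C1 C2 : ℝ, 0 ≤ C1 ∧ 0 ≤ C2 ∧ ∀ x : List ℕ, x ≠ [] →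
      DegSeq.seqGen l1 l2 m2 (fun z => ‖(z.map (fun k => φ k - c)).sum‖ ^ 2 * sqrtDecay z.length
        + (C1 * ((z.map ρ).sum * sqrtDecay z.length) + C2 * (1 / √(z.length : ℝ)))) x ≤ 0 := by
  set b2 := ‖φ 1 - c‖ ^ 2 with hb2
  set C1 := 2 * C / l1 with hC1
  set C3 := C + 2 * l1 * b2 + C1 * l1 * ρ 1 with hC3
  have hC := hφ.C_nonneg
  have hρ1 := hφ.rho_nonneg 1
  have hC1n : 0 ≤ C1 := by positivity
  have hC3n : 0 ≤ C3 := by positivity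
  refine ⟨C1, 8 * C3 / l1, hC1n, by positivity, fun x hx => ?_⟩
  have hn : 1 ≤ x.length := List.length_pos_iff.2 hx
  have hn' : (1 : ℝ) ≤ x.length := by exact_mod_cast hn
  rw [DegSeq.seqGen_add, DegSeq.seqGen_add, DegSeq.seqGen_const_mul, DegSeq.seqGen_const_mul,
    DegSeq.seqGen_norm_sq_mul, DegSeq.seqGen_sum_mul,
    DegSeq.seqGen_length l1 l2 m2 (fun n => 1 / √(n : ℝ)), ← hb2]
  have hin := hφ.inner_drift_le x
  set Y := (x.map (fun k => φ k - c)).sum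
  set R := (x.map ρ).sum
  set n : ℝ := (x.length : ℝ)
  set I := inner ℝ Y ((x.map (degGen l2 m2 φ)).sum + (n * l1) • (φ 1 - c))
  set S' := ‖Y + (φ 1 - c)‖ ^ 2
  have hR : 0 ≤ R := List.sum_nonneg fun a ha => by
    obtain ⟨k, -, rfl⟩ := List.mem_map.1 ha
    exact hφ.rho_nonneg k
  have hq : (x.map (quadVar l2 m2 φ)).sum ≤ C * (n + R) := by
    refine (List.sum_le_sum fun k _ => hφ.quad_le k).trans_eq ?_
    rw [List.sum_map_mul_left, List.sum_map_add]
    simp [n, R]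
  have hg : (x.map (degGen l2 m2 ρ)).sum ≤ 0 := by
    refine (List.sum_le_sum (g := fun _ => (0 : ℝ)) fun k _ => hφ.gen_rho_nonpos k).trans_eq ?_
    simp
  have hS : ‖Y‖ ^ 2 ≤ 2 * S' + 2 * b2 := by
    have h1 : ‖Y‖ ≤ ‖Y + (φ 1 - c)‖ + ‖φ 1 - c‖ := by
      simpa using norm_sub_le (Y + (φ 1 - c)) (φ 1 - c)
    simp only [S', hb2]
    nlinarith [sq_nonneg (‖Y + (φ 1 - c)‖ - ‖φ 1 - c‖), norm_nonneg Y]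
  have hS' : 0 ≤ S' := by positivity
  have hb2' : 0 ≤ b2 := by positivity
  have hh := half_sqrtDecay_le hn
  have hψ := sqrtDecay_le_sub hn
  have hpos := sqrtDecay_pos hn
  set h := sqrtDecay x.length
  set h' := sqrtDecay (x.length + 1)
  set Δ := 1 / √(x.length : ℝ) - 1 / √((x.length + 1 : ℕ) : ℝ)
  have hh' : h' ≤ h := by
    by_contra hcon
    push Not at hcon
    nlinarith
  set Q := (x.map (quadVar l2 m2 φ)).sum
  set G := (x.map (degGen l2 m2 ρ)).sum
  -- the contribution of the squared norm
  have k1 : h * (2 * I + Q + n * l1 * b2) - n * l1 * (h - h') * S'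
      ≤ h * (C * (n + R) + 2 * l1 * b2 * n) := by
    have a1 := mul_le_mul_of_nonneg_right hh (mul_nonneg hl1.le hS')
    have a2 : h * (2 * I) ≤ h * (l1 / 4 * (2 * S' + 2 * b2)) := by
      refine mul_le_mul_of_nonneg_left ?_ hpos.le
      linarith [mul_le_mul_of_nonneg_left hS (show 0 ≤ l1 / 4 by linarith)]
    have a3 := mul_le_mul_of_nonneg_left hq hpos.le
    have a4 : h * (l1 / 2 * b2) ≤ h * (l1 * b2 * n) := by
      refine mul_le_mul_of_nonneg_left ?_ hpos.le
      nlinarith [mul_nonneg hl1.le hb2']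
    linarith
  -- the contribution of `ρ`
  have k2 : h * G + n * l1 * (ρ 1 * h' - R * (h - h'))
      ≤ h * (l1 * ρ 1 * n) - l1 * R * (h / 2) := by
    have a1 : h * G ≤ 0 := mul_nonpos_of_nonneg_of_nonpos hpos.le hg
    have a2 : n * l1 * (ρ 1 * h') ≤ n * l1 * (ρ 1 * h) := by gcongr
    have a3 := mul_le_mul_of_nonneg_right hh (mul_nonneg hl1.le hR)
    linarith
  -- the contribution of `n ^ (-1/2)`
  have k3 : 8 * C3 / l1 * -(n * l1 * Δ) ≤ -(h * (C3 * n)) := by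
    have e : 8 * C3 / l1 * -(n * l1 * Δ) = -(8 * C3 * n * Δ) := by field_simp
    rw [e]
    have := mul_le_mul_of_nonneg_left hψ (show 0 ≤ 8 * C3 * n by positivity)
    linarith
  have k2' := mul_le_mul_of_nonneg_left k2 hC1n
  have e1 : C1 * (l1 * R * (h / 2)) = C * R * h := by rw [hC1]; field_simp
  have e2 : h * (C3 * n) = h * (C * n + 2 * l1 * b2 * n + C1 * l1 * ρ 1 * n) := by rw [hC3]; ring
  linarith

end IsDegreeStatistic
/-! ### Convergence of the empirical degree distribution -/

lemma inv_sqrt_eq_mul_sqrtDecay {n : ℕ} (hn : 1 ≤ n) : 1 / √(n : ℝ) = n * sqrtDecay n := by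
  have : (0 : ℝ) < n := by exact_mod_cast hn
  unfold sqrtDecay; field_simp

/-- The arithmetic-geometric mean inequality for `s / n`, where `s / n` is the geometric mean of
`s ^ 2 * n ^ (-3/2)` and `n ^ (-1/2)`. -/
lemma div_le_sq_mul_sqrtDecay {n : ℕ} (hn : 1 ≤ n) {s ε : ℝ} (hε : 0 < ε) :
    s / n ≤ ε / 2 * (s ^ 2 * sqrtDecay n) + 1 / (2 * ε) * (1 / √(n : ℝ)) := by
  have hn' : (0 : ℝ) < n := by exact_mod_cast hn
  have hr : 0 < √(n : ℝ) := Real.sqrt_pos.2 hn'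
  have hr2 : √(n : ℝ) ^ 2 = n := Real.sq_sqrt hn'.le
  unfold sqrtDecay
  generalize √(n : ℝ) = r at *
  rw [← hr2]
  have : ε / 2 * (s ^ 2 * (1 / (r ^ 2 * r))) + 1 / (2 * ε) * (1 / r) - s / r ^ 2
      = (ε * s - r) ^ 2 / (2 * ε * r ^ 3) := by
    field_simp; ring
  have h2 : 0 ≤ (ε * s - r) ^ 2 / (2 * ε * r ^ 3) := by positivity
  linarith

namespace IsInDegreeChain

open DegSeq

variable {Ω : Type*} [MeasurableSpace Ω] {P : Measure Ω} [IsProbabilityMeasure P]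
  {l1 l2 m2 : ℝ} {d : ℕ → Ω → DegSeq}

/-- Since `ℓ + ‖·‖` grows at most linearly, the conditional probability of a new vertex at time `t`
is at least of order `1 / t`, so that the number of vertices tends to infinity. -/
lemma lintegral_inv_sqrt_le (hl1 : 0 < l1) (hl2 : 0 < l2) (hm2 : 0 ≤ m2)
    (hd : IsInDegreeChain l1 l2 m2 P d) (t : ℕ) :
    ∫⁻ ω, ENNReal.ofReal (1 / √((d t ω).1.length : ℝ)) ∂P
      ≤ ENNReal.ofReal (Real.exp (-(l1 / (16 * (l1 + l2 + m2)) *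
          ∑ s ∈ Finset.range t, 1 / ((s : ℝ) + 1)))) := by
  set r := l1 / (16 * (l1 + l2 + m2)) with hr
  induction t with
  | zero =>
    rw [hd.lintegral_zero (fun z => 1 / √(z.length : ℝ))]
    simp
  | succ t ih =>
    refine (hd.lintegral_succ_le hl1 hl2 hm2 t (F := fun z => 1 / √(z.length : ℝ))
      (G := fun z => Real.exp (-(r * (1 / ((t : ℝ) + 1)))) * (1 / √(z.length : ℝ)))
      (fun x => by positivity) fun x hx => ?_).trans ?_
    · have hb := hd.sum_add_length_le t x hx
      have hN := rate_pos hl1 hl2 hm2 x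
      have hn : 1 ≤ x.1.length := x.length_pos
      have hψ := sqrtDecay_le_sub hn
      rw [stepMean_eq hl1 hl2 hm2, seqGen_length l1 l2 m2 (fun n => 1 / √(n : ℝ))]
      have e := inv_sqrt_eq_mul_sqrtDecay hn
      have hpos : 0 < 1 / √(x.1.length : ℝ) := by
        rw [e]; exact mul_pos (by exact_mod_cast hn) (sqrtDecay_pos hn)
      have h1 : -((x.1.length : ℝ) * l1 * (1 / √(x.1.length : ℝ)
          - 1 / √((x.1.length + 1 : ℕ) : ℝ))) ≤ -(l1 / 8 * (1 / √(x.1.length : ℝ))) := by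
        have := mul_le_mul_of_nonneg_left hψ
          (show 0 ≤ (x.1.length : ℝ) * l1 by positivity)
        rw [e] at *
        linarith
      have hN2 : (l2 + m2) * (x.1.sum : ℝ) + (x.1.length : ℝ) * l1
          ≤ (l1 + l2 + m2) * (2 * ((t : ℝ) + 1)) := by
        have hb' : (x.1.sum : ℝ) + x.1.length ≤ 2 * ((t : ℝ) + 1) := by exact_mod_cast hb
        have h3 : (0 : ℝ) ≤ x.1.sum := Nat.cast_nonneg _
        have h4 : (0 : ℝ) ≤ x.1.length := Nat.cast_nonneg _
        nlinarith [mul_nonneg hl1.le h3, mul_nonneg hl2.le h4, mul_nonneg hm2 h4,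
          mul_le_mul_of_nonneg_left hb' (show 0 ≤ l1 + l2 + m2 by linarith)]
      have h2 : r * (1 / ((t : ℝ) + 1)) * (1 / √(x.1.length : ℝ))
          ≤ l1 / 8 * (1 / √(x.1.length : ℝ)) /
            ((l2 + m2) * (x.1.sum : ℝ) + (x.1.length : ℝ) * l1) := by
        rw [le_div_iff₀ hN]
        refine (mul_le_mul_of_nonneg_left hN2 (by positivity)).trans_eq ?_
        rw [hr]; field_simp; ring
      have h3 := div_le_div_of_nonneg_right h1 hN.le
      rw [neg_div _ (l1 / 8 * _)] at h3
      have h4 := mul_le_mul_of_nonneg_right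
        (Real.add_one_le_exp (-(r * (1 / ((t : ℝ) + 1))))) hpos.le
      linarith
    · simp_rw [ENNReal.ofReal_mul (Real.exp_pos _).le]
      rw [lintegral_const_mul']
      · refine (mul_le_mul_right ih _).trans_eq ?_
        rw [← ENNReal.ofReal_mul (Real.exp_pos _).le, ← Real.exp_add, Finset.sum_range_succ]
        congr 2; ring
      · exact ENNReal.ofReal_ne_top

lemma tendsto_lintegral_inv_sqrt (hl1 : 0 < l1) (hl2 : 0 < l2) (hm2 : 0 ≤ m2)
    (hd : IsInDegreeChain l1 l2 m2 P d) :
    Tendsto (fun t => (∫⁻ ω, ENNReal.ofReal (1 / √((d t ω).1.length : ℝ)) ∂P).toReal) atTop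
      (𝓝 0) := by
  have hr : 0 < l1 / (16 * (l1 + l2 + m2)) := by positivity
  refine squeeze_zero (fun t => ENNReal.toReal_nonneg) (fun t => ?_)
    (Real.tendsto_exp_neg_atTop_nhds_zero.comp
      (Real.tendsto_sum_range_one_div_nat_succ_atTop.const_mul_atTop hr))
  exact ENNReal.toReal_le_of_le_ofReal (Real.exp_pos _).le
    (hd.lintegral_inv_sqrt_le hl1 hl2 hm2 t)

variable {H : Type*} [NormedAddCommGroup H] [InnerProductSpace ℝ H] {p : ℕ → ℝ}
  {φ : ℕ → H} {c : H} {ρ : ℕ → ℝ} {C : ℝ}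

/-- The supermartingale bound: `E[‖Y‖² n ^ (-3/2)]` is bounded uniformly in time. -/
lemma exists_lintegral_norm_sq_le (hl1 : 0 < l1) (hl2 : 0 < l2) (hm2 : 0 ≤ m2)
    (hd : IsInDegreeChain l1 l2 m2 P d) (hφ : IsDegreeStatistic l1 l2 m2 p φ c ρ C) :
    ∃ B : ℝ, 0 ≤ B ∧ ∀ t, ∫⁻ ω, ENNReal.ofReal
      (‖((d t ω).1.map (fun k => φ k - c)).sum‖ ^ 2 * sqrtDecay (d t ω).1.length) ∂P
        ≤ ENNReal.ofReal B := by
  obtain ⟨C1, C2, hC1, hC2, hF⟩ := hφ.exists_seqGen_nonpos hl1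
  set F : List ℕ → ℝ := fun z => ‖(z.map (fun k => φ k - c)).sum‖ ^ 2 * sqrtDecay z.length
        + (C1 * ((z.map ρ).sum * sqrtDecay z.length) + C2 * (1 / √(z.length : ℝ))) with hFdef
  have hrest : ∀ z : List ℕ,
      0 ≤ C1 * ((z.map ρ).sum * sqrtDecay z.length) + C2 * (1 / √(z.length : ℝ)) := by
    intro z
    have : 0 ≤ (z.map ρ).sum := List.sum_nonneg fun a ha => by
      obtain ⟨k, -, rfl⟩ := List.mem_map.1 ha
      exact hφ.rho_nonneg k
    have := sqrtDecay_nonneg z.length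
    positivity
  have hF0 : ∀ z, 0 ≤ F z := fun z =>
    add_nonneg (mul_nonneg (by positivity) (sqrtDecay_nonneg _)) (hrest z)
  refine ⟨F [1], hF0 _, fun t => ?_⟩
  have hmain : ∫⁻ ω, ENNReal.ofReal (F (d t ω).1) ∂P ≤ ENNReal.ofReal (F [1]) := by
    induction t with
    | zero => exact (hd.lintegral_zero F).le
    | succ t ih =>
      refine (hd.lintegral_succ_le hl1 hl2 hm2 t hF0 fun x _ => ?_).trans ih
      rw [stepMean_eq hl1 hl2 hm2]
      have := div_nonpos_of_nonpos_of_nonneg (hF x.1 x.2) (rate_pos hl1 hl2 hm2 x).le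
      linarith
  refine (lintegral_mono fun ω => ENNReal.ofReal_le_ofReal ?_).trans hmain
  exact le_add_of_nonneg_right (hrest _)

/-- If the indicator of the degree `j` is an affine function `β + ⟪a, φ⟫` of the statistic, then
the probability that a uniform vertex has degree `j` converges to `β + ⟪a, c⟫`. -/
theorem tendsto_real_eq (hl1 : 0 < l1) (hl2 : 0 < l2) (hm2 : 0 ≤ m2)
    (hd : IsInDegreeChain l1 l2 m2 P d) {D : ℕ → Ω → ℕ} (hD : IsUniformVertexDegree P d D)
    (hφ : IsDegreeStatistic l1 l2 m2 p φ c ρ C) (j : ℕ) (β : ℝ) (a : H)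
    (ha : ∀ k, β + inner ℝ a (φ k) = if k = j then 1 else 0) :
    Tendsto (fun t => P.real {ω | D t ω = j}) atTop (𝓝 (β + inner ℝ a c)) := by
  obtain ⟨B, hB0, hB⟩ := hd.exists_lintegral_norm_sq_le hl1 hl2 hm2 hφ
  set e : ℕ → ℝ := fun t => (∫⁻ ω, ENNReal.ofReal (1 / √((d t ω).1.length : ℝ)) ∂P).toReal
    with he
  have hefin : ∀ t, ∫⁻ ω, ENNReal.ofReal (1 / √((d t ω).1.length : ℝ)) ∂P = ENNReal.ofReal (e t) :=
    fun t => (ENNReal.ofReal_toReal (ne_top_of_le_ne_top ENNReal.ofReal_ne_top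
      (hd.lintegral_inv_sqrt_le hl1 hl2 hm2 t))).symm
  have he0 : ∀ t, 0 ≤ e t := fun t => ENNReal.toReal_nonneg
  have key : ∀ ε : ℝ, 0 < ε → ∀ t, |P.real {ω | D t ω = j} - (β + inner ℝ a c)|
      ≤ ‖a‖ * (ε / 2 * B + 1 / (2 * ε) * e t) := by
    intro ε hε t
    have hV : ∀ x : DegSeq, (x.1.map (fun k => if k = j then (1 : ℝ) else 0)).sum
          / (x.1.length : ℝ) - (β + inner ℝ a c)
        = inner ℝ a (x.1.map (fun k => φ k - c)).sum / (x.1.length : ℝ) := by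
      intro x
      have hn : (0 : ℝ) < x.1.length := by exact_mod_cast x.length_pos
      have e1 : inner ℝ a (x.1.map φ).sum = (x.1.map (fun k => inner ℝ a (φ k))).sum := by
        have := map_list_sum (innerSL ℝ a) (x.1.map φ)
        simpa [List.map_map, Function.comp_def] using this
      simp_rw [← ha, List.sum_map_add, List.sum_map_sub_const, inner_sub_right, inner_smul_right,
        e1]
      simp only [List.map_const', List.sum_replicate, nsmul_eq_mul]
      field_simp
      ring
    have hint : Integrable (fun ω => ((d t ω).1.map (fun k => if k = j then (1 : ℝ) else 0)).sum
          / ((d t ω).1.length : ℝ)) P := by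
      refine Integrable.of_bound (C := 1) (((measurable_of_countable fun x : DegSeq =>
        (x.1.map (fun k => if k = j then (1 : ℝ) else 0)).sum / (x.1.length : ℝ)).comp
          (hd.measurable t)).aestronglyMeasurable) (Eventually.of_forall fun ω => ?_)
      have hn : (0 : ℝ) < (d t ω).1.length := by exact_mod_cast (d t ω).length_pos
      have h0 : 0 ≤ ((d t ω).1.map (fun k => if k = j then (1 : ℝ) else 0)).sum :=
        List.sum_nonneg fun b hb => by
          obtain ⟨k, -, rfl⟩ := List.mem_map.1 hb
          split_ifs <;> norm_num
      have h1 : ((d t ω).1.map (fun k => if k = j then (1 : ℝ) else 0)).sum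
          ≤ (d t ω).1.length := by
        refine (List.sum_le_sum (g := fun _ => (1 : ℝ)) fun k _ => ?_).trans_eq (by simp)
        split_ifs <;> norm_num
      rw [Real.norm_of_nonneg (div_nonneg h0 hn.le), div_le_one hn]
      exact h1
    have hle : ∀ x : DegSeq,
        ENNReal.ofReal ‖inner ℝ a (x.1.map (fun k => φ k - c)).sum / (x.1.length : ℝ)‖
        ≤ ENNReal.ofReal (‖a‖ * (ε / 2)) * ENNReal.ofReal
            (‖(x.1.map (fun k => φ k - c)).sum‖ ^ 2 * sqrtDecay x.1.length)
          + ENNReal.ofReal (‖a‖ * (1 / (2 * ε))) * ENNReal.ofReal (1 / √(x.1.length : ℝ)) := by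
      intro x
      have hs := sqrtDecay_nonneg x.1.length
      rw [← ENNReal.ofReal_mul (by positivity), ← ENNReal.ofReal_mul (by positivity),
        ← ENNReal.ofReal_add (by positivity) (by positivity)]
      refine ENNReal.ofReal_le_ofReal ?_
      rw [norm_div, Real.norm_of_nonneg (Nat.cast_nonneg _)]
      refine (div_le_div_of_nonneg_right (norm_inner_le_norm a _) (Nat.cast_nonneg _)).trans ?_
      rw [mul_div_assoc]
      refine (mul_le_mul_of_nonneg_left (div_le_sq_mul_sqrtDecay x.length_pos hε)
        (norm_nonneg a)).trans_eq ?_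
      ring
    rw [hD.real_eq_integral hd.measurable]
    have h1 : ∫ ω, ((d t ω).1.map (fun k => if k = j then (1 : ℝ) else 0)).sum
          / ((d t ω).1.length : ℝ) ∂P - (β + inner ℝ a c)
        = ∫ ω, inner ℝ a ((d t ω).1.map (fun k => φ k - c)).sum / ((d t ω).1.length : ℝ) ∂P := by
      simp_rw [← hV]
      rw [integral_sub hint (integrable_const _)]
      simp
    rw [h1, ← Real.norm_eq_abs]
    refine (norm_integral_le_lintegral_norm _).trans ?_
    refine ENNReal.toReal_le_of_le_ofReal (by have := he0 t; positivity) ?_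
    refine (lintegral_mono fun ω => hle (d t ω)).trans ?_
    rw [lintegral_add_right, lintegral_const_mul' _ _ ENNReal.ofReal_ne_top,
      lintegral_const_mul' _ _ ENNReal.ofReal_ne_top, hefin t]
    · rw [mul_add, ENNReal.ofReal_add (by positivity) (by have := he0 t; positivity),
        ← mul_assoc, ← mul_assoc,
        ENNReal.ofReal_mul (p := ‖a‖ * (ε / 2)) (by positivity),
        ENNReal.ofReal_mul (p := ‖a‖ * (1 / (2 * ε))) (by positivity)]
      gcongr
      exact hB t
    · exact (measurable_of_countable fun x : DegSeq => ENNReal.ofReal (‖a‖ * (1 / (2 * ε)))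
        * ENNReal.ofReal (1 / √(x.1.length : ℝ))).comp (hd.measurable t)
  have hlim : ∀ ε : ℝ, 0 < ε → Tendsto (fun t => ‖a‖ * (ε / 2 * B + 1 / (2 * ε) * e t)) atTop
      (𝓝 (‖a‖ * (ε / 2 * B))) := by
    intro ε _
    have := ((hd.tendsto_lintegral_inv_sqrt hl1 hl2 hm2).const_mul (1 / (2 * ε))).const_add
      (ε / 2 * B) |>.const_mul ‖a‖
    simpa only [mul_zero, add_zero] using this
  rw [Metric.tendsto_atTop']
  intro δ hδ
  have hε : 0 < δ / (‖a‖ * B + 1) := by positivity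
  have hlt : ‖a‖ * (δ / (‖a‖ * B + 1) / 2 * B) < δ := by
    have h0 : 0 ≤ ‖a‖ * B := by positivity
    have e1 : ‖a‖ * (δ / (‖a‖ * B + 1) / 2 * B) = δ * ((‖a‖ * B) / (2 * (‖a‖ * B + 1))) := by
      field_simp
    rw [e1]
    refine mul_lt_of_lt_one_right hδ ?_
    rw [div_lt_one (by positivity)]
    linarith
  obtain ⟨T, hT⟩ := eventually_atTop.1 ((hlim _ hε).eventually (gt_mem_nhds hlt))
  refine ⟨T, fun t ht => ?_⟩
  rw [Real.dist_eq]
  exact (key _ hε t).trans_lt (hT t ht.le)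

end IsInDegreeChain

/-! ### The linear birth-death process -/

/-- The function `∫₀ˢ exp (δ r) dr`. -/
noncomputable def expIntegral (δ s : ℝ) : ℝ := if δ = 0 then s else (Real.exp (δ * s) - 1) / δ

lemma exp_eq_one_add_mul_expIntegral (δ s : ℝ) : Real.exp (δ * s) = 1 + δ * expIntegral δ s := by
  unfold expIntegral
  split_ifs with h
  · simp [h]
  · field_simp; ring

lemma expIntegral_zero_right (δ : ℝ) : expIntegral δ 0 = 0 := by
  simp [expIntegral]

lemma hasDerivAt_expIntegral (δ s : ℝ) :
    HasDerivAt (expIntegral δ) (1 + δ * expIntegral δ s) s := by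
  rw [← exp_eq_one_add_mul_expIntegral]
  by_cases h : δ = 0
  · have : expIntegral δ = fun s => s := by funext s; simp [expIntegral, h]
    rw [this, h]
    simpa using hasDerivAt_id' s
  · have : expIntegral δ = fun s => (Real.exp (δ * s) - 1) / δ := by
      funext s; simp [expIntegral, h]
    rw [this]
    have h1 : HasDerivAt (fun s => Real.exp (δ * s)) (Real.exp (δ * s) * (δ * 1)) s :=
      ((hasDerivAt_id s).const_mul δ).exp
    have := (h1.sub_const 1).div_const δ
    refine this.congr_deriv ?_
    field_simp

lemma expIntegral_nonneg (δ : ℝ) {s : ℝ} (hs : 0 ≤ s) : 0 ≤ expIntegral δ s := by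
  unfold expIntegral
  split_ifs with h
  · exact hs
  · rcases lt_or_gt_of_ne h with h | h
    · refine div_nonneg_of_nonpos ?_ h.le
      have : Real.exp (δ * s) ≤ 1 := Real.exp_le_one_iff.2 (mul_nonpos_of_nonpos_of_nonneg h.le hs)
      linarith
    · refine div_nonneg ?_ h.le
      have : 1 ≤ Real.exp (δ * s) := Real.one_le_exp (by positivity)
      linarith

/-- The law at time `s` of the linear birth-death process with birth rate `l` and death rate `m`,
started from one individual: a geometric law modified at zero. -/
noncomputable def birthDeathLaw (l m : ℝ) : ℕ → ℝ → ℝ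
  | 0, s => m * expIntegral (l - m) s / (1 + l * expIntegral (l - m) s)
  | n + 1, s => Real.exp ((l - m) * s) * (l * expIntegral (l - m) s) ^ n
      / (1 + l * expIntegral (l - m) s) ^ (n + 2)

namespace birthDeathLaw

variable {l m : ℝ}

lemma denom_pos (hl : 0 < l) {s : ℝ} (hs : 0 ≤ s) : 0 < 1 + l * expIntegral (l - m) s := by
  have := expIntegral_nonneg (l - m) hs
  positivity

lemma nonneg (hl : 0 < l) (hm : 0 ≤ m) (j : ℕ) {s : ℝ} (hs : 0 ≤ s) :
    0 ≤ birthDeathLaw l m j s := by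
  have h1 := expIntegral_nonneg (l - m) hs
  have h2 := denom_pos (m := m) hl hs
  cases j <;> simp only [birthDeathLaw] <;> positivity

lemma apply_zero (j : ℕ) : birthDeathLaw l m j 0 = if j = 1 then 1 else 0 := by
  rcases j with _ | _ | n <;> simp [birthDeathLaw, expIntegral_zero_right]

lemma le_bound (hl : 0 < l) (hm : 0 ≤ m) (j : ℕ) {s : ℝ} (hs : 0 ≤ s) :
    birthDeathLaw l m j s ≤ 1 + m / l := by
  have h1 := expIntegral_nonneg (l - m) hs
  have h2 := denom_pos (m := m) hl hs
  have h3 := exp_eq_one_add_mul_expIntegral (l - m) s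
  have hml : 0 ≤ m / l := by positivity
  cases j with
  | zero =>
    simp only [birthDeathLaw]
    rw [div_le_iff₀ h2]
    have : m / l * (l * expIntegral (l - m) s) = m * expIntegral (l - m) s := by field_simp
    nlinarith [mul_nonneg hl.le h1]
  | succ n =>
    simp only [birthDeathLaw, h3]
    refine le_trans ?_ (le_add_of_nonneg_right hml)
    rw [div_le_one (by positivity), pow_add]
    generalize expIntegral (l - m) s = η at *
    have e1 : (l * η) ^ n ≤ (1 + l * η) ^ n := by gcongr; linarith
    have e2 : 1 + (l - m) * η ≤ (1 + l * η) ^ 2 := by nlinarith [mul_nonneg hl.le h1]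
    have e3 : 0 ≤ 1 + (l - m) * η := by rw [← h3]; positivity
    have e4 : 0 ≤ (l * η) ^ n := by positivity
    calc (1 + (l - m) * η) * (l * η) ^ n ≤ (1 + l * η) ^ 2 * (1 + l * η) ^ n := by gcongr
      _ = _ := by ring

lemma hasDerivAt_zero (hl : 0 < l) {s : ℝ} (hs : 0 ≤ s) :
    HasDerivAt (birthDeathLaw l m 0) (m * birthDeathLaw l m 1 s) s := by
  have h2 := denom_pos (m := m) hl hs
  have h3 := exp_eq_one_add_mul_expIntegral (l - m) s
  have hη := hasDerivAt_expIntegral (l - m) s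
  have h := (hη.const_mul m).div ((hη.const_mul l).const_add 1) h2.ne'
  refine h.congr_deriv ?_
  simp only [birthDeathLaw, h3]
  generalize expIntegral (l - m) s = η at *
  field_simp
  ring

/-- Kolmogorov's forward equation. -/
lemma hasDerivAt_succ (hl : 0 < l) (n : ℕ) {s : ℝ} (hs : 0 ≤ s) :
    HasDerivAt (birthDeathLaw l m (n + 1))
      (l * n * birthDeathLaw l m n s + m * (n + 2) * birthDeathLaw l m (n + 2) s
        - (l + m) * (n + 1) * birthDeathLaw l m (n + 1) s) s := by
  have h2 := denom_pos (m := m) hl hs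
  have h3 := exp_eq_one_add_mul_expIntegral (l - m) s
  have hη := hasDerivAt_expIntegral (l - m) s
  have hE : HasDerivAt (fun s => Real.exp ((l - m) * s))
      (Real.exp ((l - m) * s) * ((l - m) * 1)) s := ((hasDerivAt_id s).const_mul (l - m)).exp
  have h := (hE.mul ((hη.const_mul l).pow n)).div (((hη.const_mul l).const_add 1).pow (n + 2))
    (pow_pos h2 _).ne'
  refine h.congr_deriv ?_
  rcases n with _ | n
  · simp only [birthDeathLaw, h3, Pi.pow_apply, Pi.mul_apply]
    generalize expIntegral (l - m) s = η at *
    simp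
    field_simp
    ring
  · simp only [birthDeathLaw, h3, Pi.pow_apply, Pi.mul_apply]
    generalize expIntegral (l - m) s = η at *
    push_cast
    field_simp
    ring

lemma continuousOn (hl : 0 < l) (j : ℕ) : ContinuousOn (birthDeathLaw l m j) (Set.Ici 0) := by
  intro s hs
  cases j with
  | zero => exact (hasDerivAt_zero hl hs).continuousAt.continuousWithinAt
  | succ n => exact (hasDerivAt_succ hl n hs).continuousAt.continuousWithinAt

/-- The partial sums of the mean are bounded by the mean `exp ((l - m) s)`. -/
lemma sum_mul_le (hl : 0 < l) (M : ℕ) {s : ℝ} (hs : 0 ≤ s) :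
    ∑ k ∈ Finset.range M, (k : ℝ) * birthDeathLaw l m k s ≤ Real.exp ((l - m) * s) := by
  have h1 := expIntegral_nonneg (l - m) hs
  have h2 := denom_pos (m := m) hl hs
  set η := expIntegral (l - m) s with hη
  set β := l * η / (1 + l * η) with hβ
  have hβ0 : 0 ≤ β := by positivity
  have hβ1 : β < 1 := by rw [hβ, div_lt_one h2]; linarith
  cases M with
  | zero => simp [Real.exp_nonneg]
  | succ M =>
    rw [Finset.sum_range_succ']
    have e : ∀ k : ℕ, ((k + 1 : ℕ) : ℝ) * birthDeathLaw l m (k + 1) s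
        = Real.exp ((l - m) * s) / (1 + l * η) ^ 2 * ((k + 1 : ℝ) * β ^ k) := by
      intro k
      simp only [birthDeathLaw, ← hη, hβ, div_pow]
      push_cast
      field_simp
      ring
    have hs2 : HasSum (fun k : ℕ => (k + 1 : ℝ) * β ^ k) (1 / (1 - β) ^ 2) := by
      have := hasSum_choose_mul_geometric_of_norm_lt_one 1 (r := β)
        (by rwa [Real.norm_of_nonneg hβ0])
      simpa using this
    simp_rw [e]
    rw [← Finset.mul_sum]
    have h3 := sum_le_hasSum (Finset.range M) (fun k _ => by positivity) hs2
    have h4 : 1 - β = 1 / (1 + l * η) := by rw [hβ]; field_simp; ring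
    rw [h4] at h3
    have h5 := mul_le_mul_of_nonneg_left h3
      (show 0 ≤ Real.exp ((l - m) * s) / (1 + l * η) ^ 2 by positivity)
    refine le_trans (by simpa using h5) (le_of_eq ?_)
    field_simp

end birthDeathLaw

/-- The law of the linear birth-death process started from one individual and observed at an
independent exponential time of rate `l1`. This is the law of the degree of a typical vertex,
whose age is exponentially distributed. -/
noncomputable def degreeLaw (l1 l m : ℝ) (j : ℕ) : ℝ :=
  ∫ s in Set.Ioi (0 : ℝ), l1 * Real.exp (-(l1 * s)) * birthDeathLaw l m j s

namespace degreeLaw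

variable {l1 l m : ℝ}

lemma integrableOn_exp (hl1 : 0 < l1) :
    IntegrableOn (fun s => l1 * Real.exp (-(l1 * s))) (Set.Ioi 0) := by
  have := (exp_neg_integrableOn_Ioi 0 hl1).const_mul l1
  simpa [neg_mul, IntegrableOn] using this

lemma integral_exp (hl1 : 0 < l1) :
    ∫ s in Set.Ioi (0 : ℝ), l1 * Real.exp (-(l1 * s)) = 1 := by
  have := integral_exp_mul_Ioi (a := -l1) (by linarith) 0
  simp only [neg_mul, mul_zero, Real.exp_zero] at this
  rw [integral_const_mul, this]
  field_simp

lemma integrableOn (hl1 : 0 < l1) (hl : 0 < l) (hm : 0 ≤ m) (j : ℕ) :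
    IntegrableOn (fun s => l1 * Real.exp (-(l1 * s)) * birthDeathLaw l m j s) (Set.Ioi 0) := by
  refine Integrable.mul_bdd (c := 1 + m / l) (integrableOn_exp hl1) ?_ ?_
  · exact ((birthDeathLaw.continuousOn hl j).mono Set.Ioi_subset_Ici_self).aestronglyMeasurable
      measurableSet_Ioi
  · filter_upwards [ae_restrict_mem measurableSet_Ioi] with s hs
    have hs' : 0 ≤ s := le_of_lt hs
    rw [Real.norm_of_nonneg (birthDeathLaw.nonneg hl hm j hs')]
    exact birthDeathLaw.le_bound hl hm j hs'

lemma nonneg (hl1 : 0 < l1) (hl : 0 < l) (hm : 0 ≤ m) (j : ℕ) : 0 ≤ degreeLaw l1 l m j := by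
  refine setIntegral_nonneg measurableSet_Ioi fun s hs => ?_
  have := birthDeathLaw.nonneg hl hm j (le_of_lt hs)
  positivity

lemma le_bound (hl1 : 0 < l1) (hl : 0 < l) (hm : 0 ≤ m) (j : ℕ) :
    degreeLaw l1 l m j ≤ 1 + m / l := by
  have h : ∫ s in Set.Ioi (0 : ℝ), l1 * Real.exp (-(l1 * s)) * (1 + m / l) = 1 + m / l := by
    rw [integral_mul_const, integral_exp hl1, one_mul]
  rw [← h]
  refine setIntegral_mono_on (integrableOn hl1 hl hm j) ((integrableOn_exp hl1).mul_const _)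
    measurableSet_Ioi fun s hs => ?_
  exact mul_le_mul_of_nonneg_left (birthDeathLaw.le_bound hl hm j (le_of_lt hs)) (by positivity)

/-- Integration by parts against the exponential density. -/
lemma integral_mul_deriv (hl1 : 0 < l1) (hl : 0 < l) (hm : 0 ≤ m) (j : ℕ) {g : ℝ → ℝ}
    (hg : ∀ s, 0 ≤ s → HasDerivAt (birthDeathLaw l m j) (g s) s)
    (hgi : IntegrableOn (fun s => l1 * Real.exp (-(l1 * s)) * g s) (Set.Ioi 0)) :
    ∫ s in Set.Ioi (0 : ℝ), l1 * Real.exp (-(l1 * s)) * g s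
      = l1 * (degreeLaw l1 l m j - if j = 1 then 1 else 0) := by
  have hd : ∀ s ∈ Set.Ici (0 : ℝ),
      HasDerivAt (fun s => l1 * Real.exp (-(l1 * s)) * birthDeathLaw l m j s)
        (l1 * Real.exp (-(l1 * s)) * g s
          - l1 * (l1 * Real.exp (-(l1 * s)) * birthDeathLaw l m j s)) s := by
    intro s hs
    have hE : HasDerivAt (fun s => Real.exp (-(l1 * s))) (Real.exp (-(l1 * s)) * (-(l1 * 1))) s :=
      ((hasDerivAt_id s).const_mul l1).neg.exp
    refine ((hE.const_mul l1).mul (hg s hs)).congr_deriv ?_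
    ring
  have hint := integrableOn hl1 hl hm j
  have hlim : Tendsto (fun s => l1 * Real.exp (-(l1 * s)) * birthDeathLaw l m j s) atTop (𝓝 0) := by
    have h1 : Tendsto (fun s => l1 * Real.exp (-(l1 * s)) * (1 + m / l)) atTop (𝓝 0) := by
      have := ((Real.tendsto_exp_neg_atTop_nhds_zero.comp
        (tendsto_id.const_mul_atTop hl1)).const_mul l1).mul_const (1 + m / l)
      simpa using this
    refine squeeze_zero' ?_ ?_ h1
    · filter_upwards [eventually_ge_atTop 0] with s hs
      have := birthDeathLaw.nonneg hl hm j hs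
      positivity
    · filter_upwards [eventually_ge_atTop 0] with s hs
      exact mul_le_mul_of_nonneg_left (birthDeathLaw.le_bound hl hm j hs) (by positivity)
  have h := integral_Ioi_of_hasDerivAt_of_tendsto' hd (hgi.sub (hint.const_mul l1)) hlim
  rw [integral_sub hgi (hint.const_mul l1), integral_const_mul] at h
  simp only [mul_zero, neg_zero, Real.exp_zero, birthDeathLaw.apply_zero] at h
  unfold degreeLaw
  linarith

lemma stationary_zero (hl1 : 0 < l1) (hl : 0 < l) (hm : 0 ≤ m) :
    m * degreeLaw l1 l m 1 = l1 * degreeLaw l1 l m 0 := by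
  have e : ∀ s, l1 * Real.exp (-(l1 * s)) * (m * birthDeathLaw l m 1 s)
      = m * (l1 * Real.exp (-(l1 * s)) * birthDeathLaw l m 1 s) := fun s => by ring
  have h := integral_mul_deriv hl1 hl hm 0 (fun s hs => birthDeathLaw.hasDerivAt_zero hl hs)
    (by simp_rw [e]; exact (integrableOn hl1 hl hm 1).const_mul m)
  simp_rw [e] at h
  rw [integral_const_mul] at h
  simpa [degreeLaw] using h

lemma stationary_succ (hl1 : 0 < l1) (hl : 0 < l) (hm : 0 ≤ m) (n : ℕ) :
    l * n * degreeLaw l1 l m n + m * (n + 2) * degreeLaw l1 l m (n + 2)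
        - (l + m) * (n + 1) * degreeLaw l1 l m (n + 1)
      = l1 * (degreeLaw l1 l m (n + 1) - if n = 0 then 1 else 0) := by
  have e : ∀ s, l1 * Real.exp (-(l1 * s)) * (l * n * birthDeathLaw l m n s
        + m * (n + 2) * birthDeathLaw l m (n + 2) s
        - (l + m) * (n + 1) * birthDeathLaw l m (n + 1) s)
      = l * n * (l1 * Real.exp (-(l1 * s)) * birthDeathLaw l m n s)
        + m * (n + 2) * (l1 * Real.exp (-(l1 * s)) * birthDeathLaw l m (n + 2) s)
        - (l + m) * (n + 1) * (l1 * Real.exp (-(l1 * s)) * birthDeathLaw l m (n + 1) s) :=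
    fun s => by ring
  have i1 := (integrableOn hl1 hl hm n).const_mul (l * n)
  have i2 := (integrableOn hl1 hl hm (n + 2)).const_mul (m * (n + 2))
  have i3 := (integrableOn hl1 hl hm (n + 1)).const_mul ((l + m) * (n + 1))
  have i12 : Integrable (fun s => l * n * (l1 * Real.exp (-(l1 * s)) * birthDeathLaw l m n s)
        + m * (n + 2) * (l1 * Real.exp (-(l1 * s)) * birthDeathLaw l m (n + 2) s))
      (volume.restrict (Set.Ioi 0)) := i1.add i2
  have h := integral_mul_deriv hl1 hl hm (n + 1)
    (fun s hs => birthDeathLaw.hasDerivAt_succ hl n hs)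
    (by simp_rw [e]; exact i12.sub i3)
  simp_rw [e] at h
  rw [integral_sub i12 i3, integral_add i1 i2] at h
  simp only [integral_const_mul] at h
  simpa [degreeLaw] using h

lemma summable_mul (hl1 : 0 < l1) (hl : 0 < l) (hlm : l ≤ m) :
    Summable fun k : ℕ => (k : ℝ) * degreeLaw l1 l m k := by
  have hm : 0 ≤ m := hl.le.trans hlm
  refine summable_of_sum_range_le (c := 1)
    (fun k => mul_nonneg (Nat.cast_nonneg _) (nonneg hl1 hl hm k)) fun M => ?_
  simp only [degreeLaw, ← integral_const_mul]
  rw [← integral_finsetSum _ fun k _ => (integrableOn hl1 hl hm k).const_mul _,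
    ← integral_exp hl1]
  refine setIntegral_mono_on (integrable_finsetSum _ fun k _ =>
    (integrableOn hl1 hl hm k).const_mul _) (integrableOn_exp hl1) measurableSet_Ioi fun s hs => ?_
  have hs' : 0 ≤ s := le_of_lt hs
  have h1 : Real.exp ((l - m) * s) ≤ 1 :=
    Real.exp_le_one_iff.2 (mul_nonpos_of_nonpos_of_nonneg (by linarith) hs')
  have h2 := (birthDeathLaw.sum_mul_le (m := m) hl M hs').trans h1
  calc ∑ k ∈ Finset.range M, (k : ℝ) * (l1 * Real.exp (-(l1 * s)) * birthDeathLaw l m k s)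
      = l1 * Real.exp (-(l1 * s)) * ∑ k ∈ Finset.range M, (k : ℝ) * birthDeathLaw l m k s := by
        rw [Finset.mul_sum]; exact Finset.sum_congr rfl fun k _ => by ring
    _ ≤ l1 * Real.exp (-(l1 * s)) * 1 := mul_le_mul_of_nonneg_left h2 (by positivity)
    _ = _ := mul_one _

end degreeLaw

/-! ### The statistics of tails, for birth rate at most the death rate -/

/-- The real Hilbert space `ℓ²(ℕ)`. -/
abbrev EllTwo : Type := lp (fun _ : ℕ => ℝ) 2

namespace EllTwo

/-- The standard basis vectors. -/
noncomputable def basisVec (i : ℕ) : EllTwo := lp.single 2 i (1 : ℝ)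

lemma inner_basisVec_left (i : ℕ) (y : EllTwo) : inner ℝ (basisVec i) y = y i := by
  simp [basisVec, lp.inner_single_left]

lemma inner_basisVec_right (i : ℕ) (y : EllTwo) : inner ℝ y (basisVec i) = y i := by
  rw [real_inner_comm, inner_basisVec_left]

lemma basisVec_apply (i j : ℕ) : (basisVec i) j = if j = i then 1 else 0 := by
  by_cases h : j = i
  · subst h; simp [basisVec]
  · simp [basisVec, h]

lemma norm_basisVec (i : ℕ) : ‖basisVec i‖ = 1 := by
  simp [basisVec]

lemma hasSum_apply {f : ℕ → EllTwo} {y : EllTwo} (h : HasSum f y) (i : ℕ) :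
    HasSum (fun k => f k i) (y i) := by
  have := h.mapL (innerSL ℝ (basisVec i))
  simpa only [innerSL_apply_apply, inner_basisVec_left] using this

lemma sum_apply (s : Finset ℕ) (f : ℕ → EllTwo) (i : ℕ) : (∑ k ∈ s, f k) i = ∑ k ∈ s, f k i := by
  simp only [← inner_basisVec_left, inner_sum]

lemma hasSum_sq (y : EllTwo) : HasSum (fun i => (y i) ^ 2) (‖y‖ ^ 2) := by
  have := lp.hasSum_inner (𝕜 := ℝ) y y
  rw [real_inner_self_eq_norm_sq] at this
  simpa using this

lemma tendsto_apply (y : EllTwo) : Tendsto (fun i => y i) atTop (𝓝 0) := by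
  have h := (hasSum_sq y).summable.tendsto_atTop_zero.sqrt
  simp only [Real.sqrt_sq_eq_abs, Real.sqrt_zero] at h
  exact (tendsto_zero_iff_abs_tendsto_zero _).2 h

end EllTwo

open EllTwo

lemma Finsupp.exists_linearCombination_eq_sum (a : ℕ →₀ ℝ) :
    ∃ M, (∀ k, M ≤ k → a k = 0) ∧ ∀ {E : Type} [AddCommGroup E] [Module ℝ E] (g : ℕ → E),
      Finsupp.linearCombination ℝ g a = ∑ k ∈ Finset.range M, a k • g k := by
  obtain ⟨M, hM⟩ := a.support.exists_nat_subset_range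
  refine ⟨M, fun k hk => ?_, fun {E} _ _ g => ?_⟩
  · by_contra h
    have := Finset.mem_range.1 (hM (Finsupp.mem_support_iff.2 h))
    omega
  · rw [Finsupp.linearCombination_apply, Finsupp.sum_of_support_subset a hM _ (by simp)]

/-- The statistic whose coordinate `i` is the indicator of a degree larger than `i`. -/
noncomputable def tailStat (k : ℕ) : EllTwo := ∑ i ∈ Finset.range k, basisVec i

namespace tailStat

lemma apply (k i : ℕ) : tailStat k i = if i < k then 1 else 0 := by
  rw [tailStat, sum_apply]
  simp [basisVec_apply]

lemma succ_sub (k : ℕ) : tailStat (k + 1) - tailStat k = basisVec k := by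
  simp [tailStat, Finset.sum_range_succ]

lemma norm_le (k : ℕ) : ‖tailStat k‖ ≤ k := by
  refine (norm_sum_le _ _).trans ?_
  simp [norm_basisVec]

lemma degGen_succ (l m : ℝ) (k : ℕ) : degGen l m tailStat (k + 1)
    = (((k + 1 : ℕ) : ℝ) * l) • basisVec (k + 1) - (((k + 1 : ℕ) : ℝ) * m) • basisVec k := by
  rw [degGen, succ_sub, Nat.add_sub_cancel, ← neg_sub (tailStat (k + 1)), succ_sub, smul_neg,
    sub_eq_add_neg]

lemma degGen_zero (l m : ℝ) : degGen l m tailStat 0 = 0 := by simp [degGen]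

lemma norm_degGen_le {l m : ℝ} (hl : 0 ≤ l) (hm : 0 ≤ m) (k : ℕ) :
    ‖degGen l m tailStat k‖ ≤ (l + m) * k := by
  cases k with
  | zero => simp [degGen_zero]
  | succ k =>
    rw [degGen_succ]
    refine (norm_sub_le _ _).trans ?_
    rw [norm_smul, norm_smul, norm_basisVec, norm_basisVec, Real.norm_of_nonneg (by positivity),
      Real.norm_of_nonneg (by positivity)]
    exact le_of_eq (by ring)

/-- With `a (k + 1) = Y k - Y (k + 1)` the quadratic form is bounded, term by term, by a
nonpositive multiple of `k (Y (k - 1) ^ 2 - Y k ^ 2)`, and summation by parts gives a sum of squares. -/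
lemma dissipative {l m : ℝ} (hl : 0 ≤ l) (hlm : l ≤ m) (a : ℕ →₀ ℝ) :
    inner ℝ (Finsupp.linearCombination ℝ tailStat a)
      (Finsupp.linearCombination ℝ (degGen l m tailStat) a) ≤ 0 := by
  obtain ⟨M, hM, hlc⟩ := a.exists_linearCombination_eq_sum
  have hm : 0 ≤ m := hl.trans hlm
  rw [hlc, hlc]
  set Y := ∑ k ∈ Finset.range M, a k • tailStat k with hY
  have hT : ∀ i, Y i = ∑ k ∈ Finset.range M, if i < k then a k else 0 := by
    intro i
    rw [hY, sum_apply]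
    refine Finset.sum_congr rfl fun k _ => ?_
    simp [apply]
  have hT0 : Y M = 0 := by
    rw [hT]
    refine Finset.sum_eq_zero fun k hk => if_neg ?_
    have := Finset.mem_range.1 hk; omega
  have hdiff : ∀ k, a (k + 1) = Y k - Y (k + 1) := by
    intro k
    rw [hT, hT, ← Finset.sum_sub_distrib]
    by_cases hk : k + 1 < M
    · rw [Finset.sum_eq_single_of_mem (k + 1) (Finset.mem_range.2 hk)]
      · simp
      · intro b _ hb
        by_cases h1 : k < b
        · rw [if_pos h1, if_pos (by omega), sub_self]
        · rw [if_neg h1, if_neg (by omega), sub_self]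
    · rw [hM _ (by omega), Finset.sum_eq_zero]
      intro b hb
      have := Finset.mem_range.1 hb
      rw [if_neg (by omega), if_neg (by omega), sub_self]
  -- the sum may be extended by one term, where the boundary term of the summation by parts is zero
  have hext : inner ℝ Y (∑ k ∈ Finset.range M, a k • degGen l m tailStat k)
      = ∑ k ∈ Finset.range M, a (k + 1) * (((k + 1 : ℕ) : ℝ) * l * Y (k + 1)
          - ((k + 1 : ℕ) : ℝ) * m * Y k) := by
    have h1 : ∑ k ∈ Finset.range M, a k • degGen l m tailStat k
        = ∑ k ∈ Finset.range (M + 1), a k • degGen l m tailStat k := by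
      rw [Finset.sum_range_succ, hM M le_rfl, zero_smul, add_zero]
    rw [h1, Finset.sum_range_succ', degGen_zero, smul_zero, add_zero, inner_sum]
    refine Finset.sum_congr rfl fun k _ => ?_
    rw [degGen_succ]
    simp only [inner_smul_right, inner_sub_right, inner_basisVec_right]
  have habel : ∀ N : ℕ, ∑ k ∈ Finset.range N, ((k + 1 : ℕ) : ℝ) * (Y k ^ 2 - Y (k + 1) ^ 2)
      = ∑ k ∈ Finset.range N, Y k ^ 2 - N * Y N ^ 2 := by
    intro N
    induction N with
    | zero => simp
    | succ N ih => rw [Finset.sum_range_succ, Finset.sum_range_succ, ih]; push_cast; ring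
  have hle : inner ℝ Y (∑ k ∈ Finset.range M, a k • degGen l m tailStat k)
      ≤ (l - m) / 2 * ∑ k ∈ Finset.range M, ((k + 1 : ℕ) : ℝ) * (Y k ^ 2 - Y (k + 1) ^ 2) := by
    rw [hext, Finset.mul_sum]
    refine Finset.sum_le_sum fun k _ => ?_
    rw [hdiff]
    have h1 : (0 : ℝ) ≤ ((k + 1 : ℕ) : ℝ) := Nat.cast_nonneg _
    nlinarith [mul_nonneg h1 (mul_nonneg (add_nonneg hl hm) (sq_nonneg (Y k - Y (k + 1))))]
  refine hle.trans (mul_nonpos_of_nonpos_of_nonneg (by linarith) ?_)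
  rw [habel, hT0]
  have : 0 ≤ ∑ k ∈ Finset.range M, Y k ^ 2 := Finset.sum_nonneg fun k _ => sq_nonneg _
  simpa using this

lemma quadVar_le (l m : ℝ) (k : ℕ) :
    quadVar l m tailStat k ≤ (l + m) * k := by
  cases k with
  | zero => simp [quadVar]
  | succ k =>
    rw [quadVar, succ_sub, Nat.add_sub_cancel, norm_sub_rev, succ_sub, norm_basisVec, norm_basisVec]
    exact le_of_eq (by ring)

variable {l1 l m : ℝ}

lemma summable_smul (hl1 : 0 < l1) (hl : 0 < l) (hlm : l ≤ m) :
    Summable fun k => degreeLaw l1 l m k • tailStat k := by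
  refine Summable.of_norm_bounded (degreeLaw.summable_mul hl1 hl hlm) fun k => ?_
  have h0 := degreeLaw.nonneg hl1 hl (hl.le.trans hlm) k
  rw [norm_smul, Real.norm_of_nonneg h0, mul_comm]
  exact mul_le_mul_of_nonneg_right (norm_le k) h0

lemma summable_smul_degGen (hl1 : 0 < l1) (hl : 0 < l) (hlm : l ≤ m) :
    Summable fun k => degreeLaw l1 l m k • degGen l m tailStat k := by
  have hm : 0 ≤ m := hl.le.trans hlm
  refine Summable.of_norm_bounded ((degreeLaw.summable_mul hl1 hl hlm).mul_left (l + m))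
    fun k => ?_
  have h0 := degreeLaw.nonneg hl1 hl hm k
  rw [norm_smul, Real.norm_of_nonneg h0, ← mul_assoc, mul_comm]
  exact mul_le_mul_of_nonneg_right (norm_degGen_le hl.le hm k) h0

lemma degreeLaw_succ_eq (hl1 : 0 < l1) (hl : 0 < l) (hlm : l ≤ m) (i : ℕ) :
    degreeLaw l1 l m (i + 1) = (∑' k, degreeLaw l1 l m k • tailStat k : EllTwo) i
      - (∑' k, degreeLaw l1 l m k • tailStat k : EllTwo) (i + 1) := by
  have h := (hasSum_apply (summable_smul hl1 hl hlm).hasSum i).sub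
    (hasSum_apply (summable_smul hl1 hl hlm).hasSum (i + 1))
  refine (hasSum_ite_eq (i + 1) (degreeLaw l1 l m (i + 1))).unique (h.congr_fun fun k => ?_)
  simp only [lp.coeFn_smul, Pi.smul_apply, apply, smul_eq_mul]
  split_ifs <;> first | omega | (subst_vars; simp)

/-- The flux of mass from degree `i` to degree `i + 1` under the stationary law, which comes from
summing the stationarity equations over all larger degrees. -/
lemma flux_eq (hl1 : 0 < l1) (hl : 0 < l) (hlm : l ≤ m) (i : ℕ) :
    l * i * degreeLaw l1 l m i - m * (i + 1) * degreeLaw l1 l m (i + 1)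
      = l1 * ((∑' k, degreeLaw l1 l m k • tailStat k : EllTwo) i - if i = 0 then 1 else 0) := by
  have hm : 0 ≤ m := hl.le.trans hlm
  set c : EllTwo := ∑' k, degreeLaw l1 l m k • tailStat k with hc
  set Z : ℕ → ℝ := fun i => l * i * degreeLaw l1 l m i - m * (i + 1) * degreeLaw l1 l m (i + 1)
      - l1 * (c i - if i = 0 then 1 else 0) with hZ
  have hstep : ∀ i, Z (i + 1) = Z i := by
    intro i
    have h1 := degreeLaw.stationary_succ hl1 hl hm i
    have h2 := degreeLaw_succ_eq hl1 hl hlm i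
    rw [← hc] at h2
    simp only [hZ, Nat.cast_add_one, Nat.add_eq_zero_iff, one_ne_zero, and_false, if_false]
    have e : i + 1 + 1 = i + 2 := rfl
    rw [e]
    have h3 : l1 * degreeLaw l1 l m (i + 1) = l1 * (c i - c (i + 1)) := by rw [h2]
    linarith
  have hconst : ∀ i, Z i = Z 0 := by
    intro i
    induction i with
    | zero => rfl
    | succ i ih => rw [hstep, ih]
  have hlim : Tendsto Z atTop (𝓝 0) := by
    have t := (degreeLaw.summable_mul hl1 hl hlm).tendsto_atTop_zero
    have t1 := (tendsto_add_atTop_iff_nat 1).2 t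
    have t2 := tendsto_apply c
    have t3 := ((t.const_mul l).sub (t1.const_mul m)).sub (t2.const_mul l1)
    simp only [mul_zero, sub_zero] at t3
    refine t3.congr' ?_
    filter_upwards [eventually_gt_atTop 0] with i hi
    simp only [hZ, if_neg hi.ne']
    push_cast
    ring
  have h0 : Z 0 = 0 := by
    refine tendsto_nhds_unique ?_ hlim
    exact tendsto_const_nhds.congr fun i => (hconst i).symm
  have := (hconst i).trans h0
  simp only [hZ] at this
  linarith

lemma isDegreeStatistic (hl1 : 0 < l1) (hl : 0 < l) (hlm : l ≤ m) :
    IsDegreeStatistic l1 l m (degreeLaw l1 l m) tailStat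
      (∑' k, degreeLaw l1 l m k • tailStat k) (fun k => (k : ℝ)) (l + m) where
  dissipative a := (dissipative hl.le hlm a).trans (by positivity)
  hasSum_mean := (summable_smul hl1 hl hlm).hasSum
  hasSum_gen := by
    have hs := (summable_smul_degGen hl1 hl hlm).hasSum
    convert hs using 1
    refine lp.ext (funext fun i => ?_)
    have h1 := hasSum_apply hs i
    have h2 : HasSum (fun k => (degreeLaw l1 l m k • degGen l m tailStat k : EllTwo) i)
        (l * i * degreeLaw l1 l m i - m * (i + 1) * degreeLaw l1 l m (i + 1)) := by
      refine ((hasSum_ite_eq i (l * i * degreeLaw l1 l m i)).sub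
        (hasSum_ite_eq (i + 1) (m * (i + 1) * degreeLaw l1 l m (i + 1)))).congr_fun fun k => ?_
      rcases k with _ | k
      · rw [degGen_zero, smul_zero]
        by_cases hi : i = 0
        · subst hi; simp
        · simp [Ne.symm hi]
      · rw [degGen_succ]
        simp only [lp.coeFn_smul, lp.coeFn_sub, Pi.smul_apply, Pi.sub_apply, basisVec_apply,
          smul_eq_mul]
        split_ifs <;> first | omega | (subst_vars; push_cast; ring)
    rw [h1.unique h2, flux_eq hl1 hl hlm]
    simp only [lp.coeFn_smul, lp.coeFn_sub, Pi.smul_apply, Pi.sub_apply, apply, smul_eq_mul,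
      Nat.lt_one_iff]
  rho_nonneg k := Nat.cast_nonneg k
  gen_rho_nonpos k := by
    cases k with
    | zero => simp [degGen]
    | succ k =>
      simp only [degGen, smul_eq_mul, Nat.add_sub_cancel]
      push_cast
      nlinarith [mul_nonneg (show (0 : ℝ) ≤ (k : ℝ) + 1 by positivity) (sub_nonneg.2 hlm)]
  C_nonneg := by linarith
  quad_le k := (quadVar_le l m k).trans
    (mul_le_mul_of_nonneg_left (by linarith) (by linarith))

end tailStat

/-! ### The weighted indicator statistics, for birth rate above the death rate -/

/-- Geometric weights `σ ^ k`, with a separate weight `ε` for the absorbing degree zero. -/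
noncomputable def geomWeight (σ ε : ℝ) (k : ℕ) : ℝ := if k = 0 then ε else σ ^ k

/-- The statistic whose coordinate `k` is the weighted indicator of the degree `k`. -/
noncomputable def pointStat (σ ε : ℝ) (k : ℕ) : EllTwo := geomWeight σ ε k • basisVec k

namespace pointStat

variable {σ ε : ℝ}

lemma geomWeight_succ (k : ℕ) : geomWeight σ ε (k + 1) = σ ^ (k + 1) := by simp [geomWeight]

lemma geomWeight_zero : geomWeight σ ε 0 = ε := by simp [geomWeight]

lemma geomWeight_pos (hσ : 0 < σ) (hε : 0 < ε) (k : ℕ) : 0 < geomWeight σ ε k := by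
  unfold geomWeight; split_ifs <;> positivity

lemma geomWeight_le (hσ : 0 < σ) (hε : 0 < ε) (k : ℕ) :
    geomWeight σ ε k ≤ (1 + ε) * σ ^ k := by
  unfold geomWeight
  split_ifs with h
  · subst h; simp
  · nlinarith [pow_pos hσ k]

lemma apply (k i : ℕ) : pointStat σ ε k i = if i = k then geomWeight σ ε k else 0 := by
  simp [pointStat, basisVec_apply]

lemma norm_eq (hσ : 0 < σ) (hε : 0 < ε) (k : ℕ) : ‖pointStat σ ε k‖ = geomWeight σ ε k := by
  rw [pointStat, norm_smul, norm_basisVec, mul_one, Real.norm_of_nonneg (geomWeight_pos hσ hε k).le]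

lemma norm_succ_sub_le (hσ : 0 < σ) (hσ1 : σ < 1) (hε : 0 < ε) (k : ℕ) :
    ‖pointStat σ ε (k + 1) - pointStat σ ε k‖ ≤ 2 * (1 + ε) * σ ^ k := by
  refine (norm_sub_le _ _).trans ?_
  rw [norm_eq hσ hε, norm_eq hσ hε]
  have h1 := geomWeight_le hσ hε k
  have h2 := geomWeight_le hσ hε (k + 1)
  have h3 : (1 + ε) * σ ^ (k + 1) ≤ (1 + ε) * σ ^ k :=
    mul_le_mul_of_nonneg_left (pow_le_pow_of_le_one hσ.le hσ1.le (Nat.le_succ k)) (by linarith)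
  linarith

lemma norm_pred_sub_le (hσ : 0 < σ) (hσ1 : σ < 1) (hε : 0 < ε) (k : ℕ) :
    ‖pointStat σ ε (k - 1) - pointStat σ ε k‖ ≤ 2 * (1 + ε) / σ * σ ^ k := by
  cases k with
  | zero => simp only [Nat.zero_sub, sub_self, norm_zero]; positivity
  | succ k =>
    rw [Nat.add_sub_cancel, norm_sub_rev]
    refine (norm_succ_sub_le hσ hσ1 hε k).trans_eq ?_
    rw [pow_succ]; field_simp

lemma norm_degGen_le {l m : ℝ} (hl : 0 ≤ l) (hm : 0 ≤ m) (hσ : 0 < σ) (hσ1 : σ < 1) (hε : 0 < ε)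
    (k : ℕ) : ‖degGen l m (pointStat σ ε) k‖
      ≤ (l * (2 * (1 + ε)) + m * (2 * (1 + ε) / σ)) * (k * σ ^ k) := by
  rw [degGen]
  refine (norm_add_le _ _).trans ?_
  rw [norm_smul, norm_smul, Real.norm_of_nonneg (by positivity), Real.norm_of_nonneg (by positivity)]
  refine (add_le_add (mul_le_mul_of_nonneg_left (norm_succ_sub_le hσ hσ1 hε k) (by positivity))
    (mul_le_mul_of_nonneg_left (norm_pred_sub_le hσ hσ1 hε k) (by positivity))).trans_eq ?_
  ring

lemma summable_mul_pow (hσ : 0 < σ) (hσ1 : σ < 1) : Summable fun k : ℕ => (k : ℝ) * σ ^ k := by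
  have := summable_pow_mul_geometric_of_norm_lt_one 1 (r := σ)
    (by rwa [Real.norm_of_nonneg hσ.le])
  simpa using this

lemma exists_quadVar_le {l m : ℝ} (hl : 0 ≤ l) (hm : 0 ≤ m) (hσ : 0 < σ) (hσ1 : σ < 1)
    (hε : 0 < ε) : ∃ C, 0 ≤ C ∧ ∀ k, quadVar l m (pointStat σ ε) k ≤ C := by
  obtain ⟨K, hK⟩ := (summable_mul_pow hσ hσ1).tendsto_atTop_zero.bddAbove_range
  have hK' : ∀ k : ℕ, (k : ℝ) * σ ^ k ≤ K := fun k => hK ⟨k, rfl⟩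
  have hK0 : 0 ≤ K := by simpa using hK' 0
  refine ⟨(l * (2 * (1 + ε)) ^ 2 + m * (2 * (1 + ε) / σ) ^ 2) * K, by positivity, fun k => ?_⟩
  have h1 : ‖pointStat σ ε (k + 1) - pointStat σ ε k‖ ^ 2 ≤ (2 * (1 + ε) * σ ^ k) ^ 2 := by
    gcongr; exact norm_succ_sub_le hσ hσ1 hε k
  have h2 : ‖pointStat σ ε (k - 1) - pointStat σ ε k‖ ^ 2 ≤ (2 * (1 + ε) / σ * σ ^ k) ^ 2 := by
    gcongr; exact norm_pred_sub_le hσ hσ1 hε k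
  have h3 : (k : ℝ) * (σ ^ k) ^ 2 ≤ K := by
    have : σ ^ k ≤ 1 := pow_le_one₀ hσ.le hσ1.le
    have h0 : 0 ≤ (k : ℝ) * σ ^ k := by positivity
    nlinarith [hK' k]
  calc quadVar l m (pointStat σ ε) k
      ≤ (k : ℝ) * l * (2 * (1 + ε) * σ ^ k) ^ 2 + (k : ℝ) * m * (2 * (1 + ε) / σ * σ ^ k) ^ 2 := by
        unfold quadVar; gcongr
    _ = (l * (2 * (1 + ε)) ^ 2 + m * (2 * (1 + ε) / σ) ^ 2) * (k * (σ ^ k) ^ 2) := by ring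
    _ ≤ _ := by gcongr

/-- Summation by parts for the quadratic form of the birth-death generator, in the coordinates
weighted by `σ ^ k` (and by `ε` at zero). The weights `σ ^ k` symmetrise the generator well enough
when `σ` lies between `√(m / l)` and `1`; the weight `ε` makes the flow into the absorbing degree
zero small. The bound has boundary terms at `N + 1` and `N + 2`. -/
lemma sum_quadForm_le {l m η : ℝ} (hl : 0 < l) (hm : 0 ≤ m) (hσ : 0 < σ) (hε : 0 < ε)
    (h1 : m ≤ l * σ ^ 2) (h2 : l * σ + m / σ ≤ l + m) (h3 : m * (ε / σ) ≤ 2 * η)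
    {y q : ℕ → ℝ} (hq0 : q 0 = 0)
    (hq1 : q 1 = l * (σ * (y 1 * y 2) - y 1 ^ 2) + m * (ε / σ * (y 0 * y 1) - y 1 ^ 2))
    (hq2 : ∀ n : ℕ, q (n + 2) = ((n : ℝ) + 2) *
      (l * (σ * (y (n + 2) * y (n + 3)) - y (n + 2) ^ 2)
        + m * (1 / σ * (y (n + 1) * y (n + 2)) - y (n + 2) ^ 2))) (N : ℕ) :
    ∑ k ∈ Finset.range (N + 2), q k ≤ η * (y 0 ^ 2 + y 1 ^ 2)
      + l * σ / 2 * (((N : ℝ) + 1) * y (N + 2) ^ 2) := by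
  set A := l * σ / 2 with hA
  set B := m / σ / 2 with hB
  have hA0 : 0 ≤ A := by positivity
  have hB0 : 0 ≤ B := by positivity
  have hBA : B ≤ A := by
    rw [hA, hB]
    have : m / σ ≤ l * σ := by rw [div_le_iff₀ hσ]; nlinarith
    linarith
  have hAB : 2 * A + 2 * B ≤ l + m := by rw [hA, hB]; linarith
  have hq1' : q 1 ≤ η * (y 0 ^ 2 + y 1 ^ 2) + A * (y 2 ^ 2 - y 1 ^ 2) - B * y 1 ^ 2 := by
    rw [hq1]
    have t1 : l * (σ * (y 1 * y 2)) ≤ A * (y 1 ^ 2 + y 2 ^ 2) := by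
      have := mul_nonneg hA0 (sq_nonneg (y 1 - y 2))
      rw [hA] at *; nlinarith
    have t2 : m * (ε / σ * (y 0 * y 1)) ≤ η * (y 0 ^ 2 + y 1 ^ 2) := by
      have t3 : y 0 * y 1 ≤ (y 0 ^ 2 + y 1 ^ 2) / 2 := by nlinarith [sq_nonneg (y 0 - y 1)]
      have t4 := mul_le_mul_of_nonneg_left t3 (show 0 ≤ m * (ε / σ) by positivity)
      have t5 := mul_le_mul_of_nonneg_right h3 (show 0 ≤ (y 0 ^ 2 + y 1 ^ 2) / 2 by positivity)
      linarith
    have t6 := mul_le_mul_of_nonneg_right hAB (sq_nonneg (y 1))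
    have t7 := mul_nonneg hB0 (sq_nonneg (y 1))
    nlinarith
  have hq2' : ∀ n : ℕ, q (n + 2) ≤ ((n : ℝ) + 2) * (A * (y (n + 3) ^ 2 - y (n + 2) ^ 2)
      + B * (y (n + 1) ^ 2 - y (n + 2) ^ 2)) := by
    intro n
    rw [hq2]
    refine mul_le_mul_of_nonneg_left ?_ (by positivity)
    have t1 : l * (σ * (y (n + 2) * y (n + 3))) ≤ A * (y (n + 2) ^ 2 + y (n + 3) ^ 2) := by
      have := mul_nonneg hA0 (sq_nonneg (y (n + 2) - y (n + 3)))
      rw [hA] at *; nlinarith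
    have t2 : m * (1 / σ * (y (n + 1) * y (n + 2))) ≤ B * (y (n + 1) ^ 2 + y (n + 2) ^ 2) := by
      have e : m * (1 / σ * (y (n + 1) * y (n + 2))) = 2 * B * (y (n + 1) * y (n + 2)) := by
        rw [hB]; field_simp
      have := mul_nonneg hB0 (sq_nonneg (y (n + 1) - y (n + 2)))
      rw [e]; nlinarith
    have t6 := mul_le_mul_of_nonneg_right hAB (sq_nonneg (y (n + 2)))
    nlinarith
  -- summation by parts
  have hsum : ∑ k ∈ Finset.range (N + 2), q k ≤ η * (y 0 ^ 2 + y 1 ^ 2)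
      + A * (((N : ℝ) + 1) * y (N + 2) ^ 2 - ∑ k ∈ Finset.range (N + 1), y (k + 1) ^ 2)
      + B * (∑ k ∈ Finset.range (N + 1), y (k + 1) ^ 2 - ((N : ℝ) + 2) * y (N + 1) ^ 2) := by
    induction N with
    | zero =>
      simp only [Finset.sum_range_succ, Finset.sum_range_zero, zero_add, hq0, Nat.cast_zero]
      linarith
    | succ N ih =>
      have := hq2' N
      rw [show N + 1 + 2 = N + 2 + 1 from rfl, Finset.sum_range_succ q (N + 2),
        Finset.sum_range_succ (fun k => y (k + 1) ^ 2) (N + 1)]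
      push_cast
      rw [show N + 2 + 1 = N + 3 from rfl, show N + 1 + 1 = N + 2 from rfl]
      linarith
  have hs : 0 ≤ ∑ k ∈ Finset.range (N + 1), y (k + 1) ^ 2 :=
    Finset.sum_nonneg fun k _ => sq_nonneg _
  have t2 := mul_le_mul_of_nonneg_right hBA hs
  have t3 : 0 ≤ B * (((N : ℝ) + 2) * y (N + 1) ^ 2) := by positivity
  linarith

/-- The quadratic form of the birth-death generator on finitely supported sequences is controlled by
`η` times the squared norm. -/
lemma dissipative {l m η : ℝ} (hl : 0 < l) (hm : 0 ≤ m) (hσ : 0 < σ) (hε : 0 < ε)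
    (h1 : m ≤ l * σ ^ 2) (h2 : l * σ + m / σ ≤ l + m) (h3 : m * (ε / σ) ≤ 2 * η)
    (a : ℕ →₀ ℝ) :
    inner ℝ (Finsupp.linearCombination ℝ (pointStat σ ε) a)
      (Finsupp.linearCombination ℝ (degGen l m (pointStat σ ε)) a)
      ≤ η * ‖Finsupp.linearCombination ℝ (pointStat σ ε) a‖ ^ 2 := by
  obtain ⟨M, hM, hlc⟩ := a.exists_linearCombination_eq_sum
  have hη : 0 ≤ η := by
    have : 0 ≤ m * (ε / σ) := by positivity
    linarith
  rw [hlc, hlc]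
  set Y := ∑ k ∈ Finset.range M, a k • pointStat σ ε k with hY
  have hb : ∀ i, Y i = a i * geomWeight σ ε i := by
    intro i
    rw [hY, sum_apply]
    simp only [lp.coeFn_smul, Pi.smul_apply, apply, smul_eq_mul, mul_ite, mul_zero]
    rw [Finset.sum_ite_eq (Finset.range M) i]
    split_ifs with h
    · rfl
    · rw [hM i (by simpa using h), zero_mul]
  have hb0 : ∀ i, M ≤ i → Y i = 0 := fun i hi => by rw [hb, hM i hi, zero_mul]
  -- the terms of the quadratic form
  set q : ℕ → ℝ := fun k => a k * inner ℝ Y (degGen l m (pointStat σ ε) k) with hq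
  have hinner : ∀ k, inner ℝ Y (pointStat σ ε k) = geomWeight σ ε k * Y k := by
    intro k
    rw [pointStat, inner_smul_right, inner_basisVec_right]
  have hq0 : q 0 = 0 := by simp [hq, degGen]
  have hσ0 := hσ.ne'
  have hq1 : q 1 = l * (σ * (Y 1 * Y 2) - Y 1 ^ 2) + m * (ε / σ * (Y 0 * Y 1) - Y 1 ^ 2) := by
    have e : Y 1 = a 1 * σ := by rw [hb, geomWeight_succ]; simp
    simp only [hq, degGen, inner_add_right, inner_smul_right, inner_sub_right, hinner,
      geomWeight_succ, Nat.sub_self, geomWeight_zero, Nat.cast_one]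
    rw [e]
    field_simp
    ring
  have hq2 : ∀ n : ℕ, q (n + 2) = ((n : ℝ) + 2) *
      (l * (σ * (Y (n + 2) * Y (n + 3)) - Y (n + 2) ^ 2)
        + m * (1 / σ * (Y (n + 1) * Y (n + 2)) - Y (n + 2) ^ 2)) := by
    intro n
    have e : Y (n + 2) = a (n + 2) * σ ^ (n + 2) := by rw [hb, geomWeight_succ]
    simp only [hq, degGen, inner_add_right, inner_smul_right, inner_sub_right, hinner,
      show n + 2 - 1 = n + 1 from rfl, geomWeight_succ]
    rw [e]
    push_cast
    field_simp
    ring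
  have hext : inner ℝ Y (∑ k ∈ Finset.range M, a k • degGen l m (pointStat σ ε) k)
      = ∑ k ∈ Finset.range (M + 2), q k := by
    rw [Finset.sum_range_succ, Finset.sum_range_succ, inner_sum]
    simp only [hq, hM M le_rfl, hM (M + 1) (Nat.le_succ M), inner_smul_right, zero_mul, add_zero]
  have hY01 : Y 0 ^ 2 + Y 1 ^ 2 ≤ ‖Y‖ ^ 2 := by
    have := sum_le_hasSum (Finset.range 2) (fun i _ => sq_nonneg (Y i)) (hasSum_sq Y)
    simpa [Finset.sum_range_succ] using this
  rw [hext]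
  refine (sum_quadForm_le hl hm hσ hε h1 h2 h3 hq0 hq1 hq2 M).trans ?_
  rw [hb0 (M + 2) (by omega)]
  have t1 := mul_le_mul_of_nonneg_left hY01 hη
  linarith

variable {l1 l m : ℝ}

lemma summable_smul (hl1 : 0 < l1) (hl : 0 < l) (hm : 0 ≤ m) (hσ : 0 < σ) (hσ1 : σ < 1)
    (hε : 0 < ε) : Summable fun k => degreeLaw l1 l m k • pointStat σ ε k := by
  refine Summable.of_norm_bounded (((summable_geometric_of_lt_one hσ.le hσ1).mul_left
    ((1 + m / l) * (1 + ε)))) fun k => ?_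
  have h0 := degreeLaw.nonneg hl1 hl hm k
  have h1 := degreeLaw.le_bound hl1 hl hm k
  have h2 := geomWeight_pos hσ hε k
  rw [norm_smul, Real.norm_of_nonneg h0, norm_eq hσ hε, mul_assoc]
  exact mul_le_mul h1 (geomWeight_le hσ hε k) h2.le (h0.trans h1)

lemma summable_smul_degGen (hl1 : 0 < l1) (hl : 0 < l) (hm : 0 ≤ m) (hσ : 0 < σ) (hσ1 : σ < 1)
    (hε : 0 < ε) :
    Summable fun k => degreeLaw l1 l m k • degGen l m (pointStat σ ε) k := by
  refine Summable.of_norm_bounded (((summable_mul_pow hσ hσ1).mul_left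
    (l * (2 * (1 + ε)) + m * (2 * (1 + ε) / σ))).mul_left (1 + m / l)) fun k => ?_
  have h0 := degreeLaw.nonneg hl1 hl hm k
  have h1 := degreeLaw.le_bound hl1 hl hm k
  rw [norm_smul, Real.norm_of_nonneg h0]
  exact mul_le_mul h1 (norm_degGen_le hl.le hm hσ hσ1 hε k) (norm_nonneg _) (h0.trans h1)

lemma mean_apply (hl1 : 0 < l1) (hl : 0 < l) (hm : 0 ≤ m) (hσ : 0 < σ) (hσ1 : σ < 1)
    (hε : 0 < ε) (i : ℕ) : (∑' k, degreeLaw l1 l m k • pointStat σ ε k : EllTwo) i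
      = degreeLaw l1 l m i * geomWeight σ ε i := by
  refine (hasSum_apply (summable_smul hl1 hl hm hσ hσ1 hε).hasSum i).unique
    ((hasSum_ite_eq i (degreeLaw l1 l m i * geomWeight σ ε i)).congr_fun fun k => ?_)
  simp only [lp.coeFn_smul, Pi.smul_apply, apply, smul_eq_mul]
  split_ifs <;> first | omega | (subst_vars; simp)

lemma hasSum_gen (hl1 : 0 < l1) (hl : 0 < l) (hm : 0 ≤ m) (hσ : 0 < σ) (hσ1 : σ < 1)
    (hε : 0 < ε) :
    HasSum (fun k => degreeLaw l1 l m k • degGen l m (pointStat σ ε) k)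
      (l1 • ((∑' k, degreeLaw l1 l m k • pointStat σ ε k) - pointStat σ ε 1)) := by
  have hs := (summable_smul_degGen hl1 hl hm hσ hσ1 hε).hasSum
  convert hs using 1
  refine lp.ext (funext fun i => ?_)
  have h1 := hasSum_apply hs i
  have hcoef : ∀ k, (degreeLaw l1 l m k • degGen l m (pointStat σ ε) k : EllTwo) i
      = degreeLaw l1 l m k * ((k : ℝ) * l * ((if i = k + 1 then geomWeight σ ε (k + 1) else 0)
          - (if i = k then geomWeight σ ε k else 0))
        + (k : ℝ) * m * ((if i = k - 1 then geomWeight σ ε (k - 1) else 0)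
          - (if i = k then geomWeight σ ε k else 0))) := by
    intro k
    simp only [degGen, lp.coeFn_smul, lp.coeFn_sub, lp.coeFn_add, Pi.smul_apply, Pi.sub_apply,
      Pi.add_apply, apply, smul_eq_mul]
  simp only [lp.coeFn_smul, lp.coeFn_sub, Pi.smul_apply, Pi.sub_apply, apply, smul_eq_mul,
    mean_apply hl1 hl hm hσ hσ1 hε]
  rcases i with _ | i
  · have h2 : HasSum (fun k => (degreeLaw l1 l m k • degGen l m (pointStat σ ε) k : EllTwo) 0)
        (m * degreeLaw l1 l m 1 * geomWeight σ ε 0) := by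
      refine (hasSum_ite_eq 1 (m * degreeLaw l1 l m 1 * geomWeight σ ε 0)).congr_fun fun k => ?_
      rw [hcoef]
      rcases k with _ | _ | k
      · simp
      · simp; ring
      · simp
    rw [h1.unique h2, degreeLaw.stationary_zero hl1 hl hm]
    simp
    ring
  · have h2 : HasSum
        (fun k => (degreeLaw l1 l m k • degGen l m (pointStat σ ε) k : EllTwo) (i + 1))
        ((l * i * degreeLaw l1 l m i + m * (i + 2) * degreeLaw l1 l m (i + 2)
          - (l + m) * (i + 1) * degreeLaw l1 l m (i + 1)) * geomWeight σ ε (i + 1)) := by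
      have h3 := (((hasSum_ite_eq i (l * i * degreeLaw l1 l m i)).add
        (hasSum_ite_eq (i + 2) (m * (i + 2) * degreeLaw l1 l m (i + 2)))).sub
        (hasSum_ite_eq (i + 1) ((l + m) * (i + 1) * degreeLaw l1 l m (i + 1)))).mul_right
        (geomWeight σ ε (i + 1))
      refine h3.congr_fun fun k => ?_
      rw [hcoef]
      rcases k with _ | k
      · split_ifs <;> first | omega | contradiction | (subst_vars; simp)
      · simp only [Nat.add_sub_cancel]
        split_ifs <;> first
          | omega
          | (subst_vars; push_cast; ring1)
          | (obtain rfl : k = i := by omega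
             push_cast
             ring1)
    rw [h1.unique h2, degreeLaw.stationary_succ hl1 hl hm]
    by_cases hi : i = 0
    · subst hi; simp; ring
    · simp [hi]; ring

lemma exists_isDegreeStatistic (hl1 : 0 < l1) (hl : 0 < l) (hm : 0 ≤ m) (hml : m < l) :
    ∃ σ ε C : ℝ, 0 < σ ∧ σ < 1 ∧ 0 < ε ∧ IsDegreeStatistic l1 l m (degreeLaw l1 l m)
      (pointStat σ ε) (∑' k, degreeLaw l1 l m k • pointStat σ ε k) (fun _ => 0) C := by
  -- the arithmetic mean of `m / l` and `1`, which is at least `√(m / l)`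
  set σ := (l + m) / (2 * l) with hσdef
  have hσ : 0 < σ := by positivity
  have hσ1 : σ < 1 := by rw [hσdef, div_lt_one (by positivity)]; linarith
  set ε := l1 * σ / (4 * (m + 1)) with hεdef
  have hε : 0 < ε := by positivity
  obtain ⟨C, hC0, hC⟩ := exists_quadVar_le (σ := σ) (ε := ε) hl.le hm hσ hσ1 hε
  refine ⟨σ, ε, C, hσ, hσ1, hε, ?_⟩
  have hlσ : l * σ = (l + m) / 2 := by rw [hσdef]; field_simp
  have h1 : m ≤ l * σ ^ 2 := by
    have : l * σ ^ 2 = (l + m) ^ 2 / (4 * l) := by rw [hσdef]; field_simp; ring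
    rw [this, le_div_iff₀ (by positivity)]
    nlinarith [sq_nonneg (l - m)]
  have h2 : l * σ + m / σ ≤ l + m := by
    have : m / σ ≤ (l + m) / 2 := by
      rw [div_le_iff₀ hσ, ← hlσ]
      nlinarith
    linarith
  have h3 : m * (ε / σ) ≤ 2 * (l1 / 8) := by
    have : m * (ε / σ) = l1 / 4 * (m / (m + 1)) := by rw [hεdef]; field_simp
    rw [this]
    have h4 : m / (m + 1) ≤ 1 := by rw [div_le_one (by positivity)]; linarith
    nlinarith
  exact
    { dissipative := dissipative hl hm hσ hε h1 h2 h3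
      hasSum_mean := (summable_smul hl1 hl hm hσ hσ1 hε).hasSum
      hasSum_gen := hasSum_gen hl1 hl hm hσ hσ1 hε
      rho_nonneg := fun _ => le_rfl
      gen_rho_nonpos := fun k => by simp [degGen]
      C_nonneg := hC0
      quad_le := fun k => by simpa using hC k }

end pointStat

/-! ### Existence of the limits -/

namespace IsInDegreeChain

variable {Ω : Type*} [MeasurableSpace Ω] {P : Measure Ω} [IsProbabilityMeasure P]
  {l1 l2 m2 : ℝ} {d : ℕ → Ω → DegSeq}

theorem tendsto_degreeLaw (hl1 : 0 < l1) (hl2 : 0 < l2) (hm2 : 0 ≤ m2)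
    (hd : IsInDegreeChain l1 l2 m2 P d) {D : ℕ → Ω → ℕ} (hD : IsUniformVertexDegree P d D)
    (j : ℕ) : Tendsto (fun t => P.real {ω | D t ω = j}) atTop (𝓝 (degreeLaw l1 l2 m2 j)) := by
  rcases le_or_gt l2 m2 with hlm | hlm
  · have hφ := tailStat.isDegreeStatistic hl1 hl2 hlm
    have hsucc := tailStat.degreeLaw_succ_eq hl1 hl2 hlm
    have hflux := tailStat.flux_eq hl1 hl2 hlm 0
    set c : EllTwo := ∑' k, degreeLaw l1 l2 m2 k • tailStat k
    rcases j with _ | j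
    · have h := hd.tendsto_real_eq hl1 hl2 hm2 hD hφ 0 1 (-basisVec 0) fun k => by
        rw [inner_neg_left, inner_basisVec_left, tailStat.apply]
        rcases k with _ | k <;> simp
      rw [inner_neg_left, inner_basisVec_left] at h
      have h0 := degreeLaw.stationary_zero hl1 hl2 hm2
      have e : degreeLaw l1 l2 m2 0 = 1 + -c 0 := by
        simp only [Nat.cast_zero, mul_zero, zero_mul, zero_sub, zero_add, mul_one, if_true]
          at hflux
        have : l1 * (degreeLaw l1 l2 m2 0 - (1 + -c 0)) = 0 := by linarith
        have := (mul_eq_zero.1 this).resolve_left hl1.ne'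
        linarith
      rwa [e]
    · have h := hd.tendsto_real_eq hl1 hl2 hm2 hD hφ (j + 1) 0 (basisVec j - basisVec (j + 1))
        fun k => by
          rw [inner_sub_left, inner_basisVec_left, inner_basisVec_left, tailStat.apply,
            tailStat.apply]
          split_ifs <;> first | omega | norm_num
      rw [inner_sub_left, inner_basisVec_left, inner_basisVec_left, zero_add] at h
      rwa [hsucc]
  · obtain ⟨σ, ε, C, hσ, hσ1, hε, hφ⟩ := pointStat.exists_isDegreeStatistic hl1 hl2 hm2 hlm
    have hw := (pointStat.geomWeight_pos hσ hε j).ne'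
    have h := hd.tendsto_real_eq hl1 hl2 hm2 hD hφ j 0
      ((geomWeight σ ε j)⁻¹ • basisVec j) fun k => by
        rw [real_inner_smul_left, inner_basisVec_left, pointStat.apply]
        by_cases hk : k = j
        · subst hk; simp [hw]
        · simp [hk, Ne.symm hk]
    rw [real_inner_smul_left, inner_basisVec_left, pointStat.mean_apply hl1 hl2 hm2 hσ hσ1 hε] at h
    convert h using 2
    field_simp
    ring

end IsInDegreeChain

/-! ### Integral formulas for the limits -/

/-- The change of variables `u = exp (-δ s)`. -/
lemma integral_Ioi_comp_exp_neg {δ : ℝ} (hδ : 0 < δ) (g : ℝ → ℝ) :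
    ∫ s in Set.Ioi (0 : ℝ), δ * Real.exp (-(δ * s)) * g (Real.exp (-(δ * s)))
      = ∫ u in (0 : ℝ)..1, g u := by
  have himg : (fun s => Real.exp (-(δ * s))) '' Set.Ioi 0 = Set.Ioo 0 1 := by
    ext u
    simp only [Set.mem_image, Set.mem_Ioi, Set.mem_Ioo]
    constructor
    · rintro ⟨s, hs, rfl⟩
      have := mul_pos hδ hs
      exact ⟨Real.exp_pos _, Real.exp_lt_one_iff.2 (by linarith)⟩
    · rintro ⟨h0, h1⟩
      refine ⟨-Real.log u / δ, div_pos (neg_pos.2 (Real.log_neg h0 h1)) hδ, ?_⟩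
      rw [mul_div_cancel₀ _ hδ.ne', neg_neg, Real.exp_log h0]
  have hder : ∀ s ∈ Set.Ioi (0 : ℝ), HasDerivWithinAt (fun s => Real.exp (-(δ * s)))
      (Real.exp (-(δ * s)) * (-(δ * 1))) (Set.Ioi 0) s := fun s _ =>
    (((hasDerivAt_id s).const_mul δ).neg.exp).hasDerivWithinAt
  have hinj : Set.InjOn (fun s => Real.exp (-(δ * s))) (Set.Ioi 0) := by
    intro a _ b _ hab
    have := Real.exp_injective hab
    exact mul_left_cancel₀ hδ.ne' (neg_injective this)
  rw [intervalIntegral.integral_of_le zero_le_one, integral_Ioc_eq_integral_Ioo, ← himg,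
    integral_image_eq_integral_abs_deriv_smul measurableSet_Ioi hder hinj]
  refine setIntegral_congr_fun measurableSet_Ioi fun s _ => ?_
  have : |Real.exp (-(δ * s)) * (-(δ * 1))| = δ * Real.exp (-(δ * s)) := by
    rw [abs_mul, abs_of_pos (Real.exp_pos _), abs_neg, mul_one, abs_of_pos hδ, mul_comm]
  simp only [this, smul_eq_mul]

/-- The integral against the exponential density in terms of `u = exp (-δ s)`, on which the
birth-death law depends rationally. -/
lemma degreeLaw_eq_integral {l1 l m δ : ℝ} (hδ : 0 < δ) (j : ℕ) (g : ℝ → ℝ)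
    (hg : ∀ s, 0 < s → birthDeathLaw l m j s = g (Real.exp (-(δ * s)))) :
    degreeLaw l1 l m j = l1 / δ * ∫ u in (0 : ℝ)..1, u ^ (l1 / δ - 1) * g u := by
  rw [← integral_Ioi_comp_exp_neg hδ, ← integral_const_mul, degreeLaw]
  refine setIntegral_congr_fun measurableSet_Ioi fun s hs => ?_
  have hu := Real.exp_pos (-(δ * s))
  have e : Real.exp (-(l1 * s)) = Real.exp (-(δ * s)) ^ (l1 / δ) := by
    rw [← Real.exp_mul]; congr 1; field_simp
  rw [hg s hs, e, Real.rpow_sub_one hu.ne']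
  field_simp

lemma beta_comm (a b : ℝ) : ProbabilityTheory.beta a b = ProbabilityTheory.beta b a := by
  unfold ProbabilityTheory.beta
  rw [mul_comm, add_comm]

lemma beta_eq_integral {a b : ℝ} (ha : 0 < a) (hb : 0 < b) :
    ProbabilityTheory.beta a b = ∫ s in (0 : ℝ)..1, s ^ (a - 1) * (1 - s) ^ (b - 1) := by
  rw [beta_eq_betaIntegralReal a b ha hb, Complex.betaIntegral]
  have : ∀ s ∈ Set.uIcc (0 : ℝ) 1, (s : ℂ) ^ ((a : ℂ) - 1) * (1 - (s : ℂ)) ^ ((b : ℂ) - 1)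
      = ((s ^ (a - 1) * (1 - s) ^ (b - 1) : ℝ) : ℂ) := by
    intro s hs
    rw [Set.uIcc_of_le zero_le_one] at hs
    rw [Complex.ofReal_mul, Complex.ofReal_cpow hs.1, Complex.ofReal_cpow (by linarith [hs.2])]
    push_cast
    rfl
  rw [intervalIntegral.integral_congr this, intervalIntegral.integral_ofReal, Complex.ofReal_re]

lemma beta_mul_gaussF {a b c' z : ℝ} (hb : 0 < b) (hc : 0 < c') :
    ProbabilityTheory.beta c' b * gaussF a b (c' + b) z
      = ∫ s in (0 : ℝ)..1, s ^ (b - 1) * ((1 - s) ^ (c' - 1) / (1 - s * z) ^ a) := by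
  have h := (beta_pos hb hc).ne'
  rw [gaussF, add_sub_cancel_right, beta_comm c' b, ← mul_assoc, mul_one_div_cancel h, one_mul]

lemma beta_mul_gaussF_zero {r z : ℝ} (hr : 0 < r) :
    ProbabilityTheory.beta 2 r * gaussF 1 r (2 + r) z
      = ∫ s in (0 : ℝ)..1, s ^ (r - 1) * ((1 - s) / (1 - s * z)) := by
  rw [beta_mul_gaussF hr two_pos]
  norm_num

lemma beta_mul_gaussF_succ {r z : ℝ} (hr : 0 < r) (n : ℕ) :
    ProbabilityTheory.beta (n + 1 : ℕ) (1 + r)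
        * gaussF ((n + 1 : ℕ) + 1) (1 + r) ((n + 1 : ℕ) + 1 + r) z
      = ∫ s in (0 : ℝ)..1, s ^ (r - 1) * (s * ((1 - s) ^ n / (1 - s * z) ^ (n + 2))) := by
  rw [add_assoc (((n + 1 : ℕ) : ℝ)) 1 r, beta_mul_gaussF (by linarith) (by positivity)]
  refine intervalIntegral.integral_congr_ae (Eventually.of_forall fun s hs => ?_)
  rw [Set.uIoc_of_le zero_le_one] at hs
  have e1 : ((n + 1 : ℕ) : ℝ) - 1 = n := by push_cast; ring
  have e2 : ((n + 1 : ℕ) : ℝ) + 1 = ((n + 2 : ℕ) : ℝ) := by push_cast; ring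
  have e3 : s ^ (1 + r - 1) = s ^ (r - 1) * s := by
    rw [add_sub_cancel_left, Real.rpow_sub_one hs.1.ne', div_mul_cancel₀ _ hs.1.ne']
  rw [e1, e2, e3, Real.rpow_natCast, Real.rpow_natCast, mul_assoc]

namespace degreeLaw

variable {l1 l m : ℝ}

section Supercritical

lemma expIntegral_of_lt (hml : m < l) (s : ℝ) :
    expIntegral (l - m) s
      = (1 - Real.exp (-((l - m) * s))) / ((l - m) * Real.exp (-((l - m) * s))) := by
  have h : l - m ≠ 0 := sub_ne_zero.2 hml.ne'
  rw [expIntegral, if_neg h, Real.exp_neg]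
  field_simp

lemma denom_of_lt {u : ℝ} (hl : 0 < l) (hml : m < l) (hu : 0 < u) :
    1 + l * ((1 - u) / ((l - m) * u)) = (l * (1 - u * (m / l))) / ((l - m) * u) := by
  have h : 0 < l - m := sub_pos.2 hml
  field_simp
  ring

lemma one_sub_mul_pos {u z : ℝ} (hu : 0 < u) (hu1 : u ≤ 1) (hz : z < 1) : 0 < 1 - u * z := by
  nlinarith

lemma eq_integral_zero_of_lt (hl : 0 < l) (hml : m < l) :
    degreeLaw l1 l m 0 = m * l1 / (l * (l - m)) *
      ∫ u in (0 : ℝ)..1, u ^ (l1 / (l - m) - 1) * ((1 - u) / (1 - u * (m / l))) := by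
  have h : 0 < l - m := sub_pos.2 hml
  have hz : m / l < 1 := by rwa [div_lt_one hl]
  rw [degreeLaw_eq_integral (l1 := l1) h 0
    (fun u => m / l * ((1 - u) / (1 - u * (m / l)))) fun s hs => ?_]
  · simp_rw [mul_left_comm _ (m / l)]
    rw [intervalIntegral.integral_const_mul, ← mul_assoc]
    congr 1
    field_simp
  · have hu := Real.exp_pos (-((l - m) * s))
    have hu1 : Real.exp (-((l - m) * s)) ≤ 1 := Real.exp_le_one_iff.2 (by
      have := mul_pos h hs; linarith)
    simp only [birthDeathLaw]
    rw [expIntegral_of_lt hml]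
    generalize Real.exp (-((l - m) * s)) = u at *
    have hp := (one_sub_mul_pos hu hu1 hz).ne'
    rw [denom_of_lt hl hml hu]
    generalize 1 - u * (m / l) = w at *
    field_simp

lemma eq_integral_succ_of_lt (hl : 0 < l) (hml : m < l) (n : ℕ) :
    degreeLaw l1 l m (n + 1) = l1 * (l - m) / l ^ 2 *
      ∫ u in (0 : ℝ)..1, u ^ (l1 / (l - m) - 1)
        * (u * ((1 - u) ^ n / (1 - u * (m / l)) ^ (n + 2))) := by
  have h : 0 < l - m := sub_pos.2 hml
  have hz : m / l < 1 := by rwa [div_lt_one hl]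
  rw [degreeLaw_eq_integral (l1 := l1) h (n + 1) (fun u => (l - m) ^ 2 / l ^ 2
    * (u * ((1 - u) ^ n / (1 - u * (m / l)) ^ (n + 2)))) fun s hs => ?_]
  · simp_rw [mul_left_comm _ ((l - m) ^ 2 / l ^ 2)]
    rw [intervalIntegral.integral_const_mul, ← mul_assoc]
    congr 1
    field_simp
  · have hu := Real.exp_pos (-((l - m) * s))
    have hu1 : Real.exp (-((l - m) * s)) ≤ 1 := Real.exp_le_one_iff.2 (by
      have := mul_pos h hs; linarith)
    have e : Real.exp ((l - m) * s) = (Real.exp (-((l - m) * s)))⁻¹ := by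
      rw [Real.exp_neg, inv_inv]
    simp only [birthDeathLaw]
    rw [expIntegral_of_lt hml, e]
    generalize Real.exp (-((l - m) * s)) = u at *
    have hp := (one_sub_mul_pos hu hu1 hz).ne'
    rw [denom_of_lt hl hml hu]
    generalize 1 - u * (m / l) = w at *
    generalize l - m = δ at *
    simp only [mul_pow, div_pow]
    field_simp
    ring

end Supercritical

section Subcritical

lemma expIntegral_of_gt (hlm : l < m) (s : ℝ) :
    expIntegral (l - m) s = (1 - Real.exp (-((m - l) * s))) / (m - l) := by
  have h : l - m ≠ 0 := sub_ne_zero.2 hlm.ne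
  have h' : m - l ≠ 0 := sub_ne_zero.2 hlm.ne'
  rw [expIntegral, if_neg h, ← neg_mul, neg_sub, ← neg_div_neg_eq, neg_sub, neg_sub]

lemma denom_of_gt {u : ℝ} (hl : 0 < l) (hlm : l < m) :
    1 + l * ((1 - u) / (m - l)) = (m * (1 - u * (l / m))) / (m - l) := by
  have h : 0 < m - l := sub_pos.2 hlm
  have hm : 0 < m := hl.trans hlm
  field_simp
  ring

lemma eq_integral_zero_of_gt (hl : 0 < l) (hlm : l < m) :
    degreeLaw l1 l m 0 = l1 / (m - l) *
      ∫ u in (0 : ℝ)..1, u ^ (l1 / (m - l) - 1) * ((1 - u) / (1 - u * (l / m))) := by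
  have h : 0 < m - l := sub_pos.2 hlm
  have hm : 0 < m := hl.trans hlm
  have hz : l / m < 1 := by rwa [div_lt_one hm]
  refine degreeLaw_eq_integral (l1 := l1) h 0
    (fun u => (1 - u) / (1 - u * (l / m))) fun s hs => ?_
  have hu := Real.exp_pos (-((m - l) * s))
  have hu1 : Real.exp (-((m - l) * s)) ≤ 1 := Real.exp_le_one_iff.2 (by
    have := mul_pos h hs; linarith)
  simp only [birthDeathLaw]
  rw [expIntegral_of_gt hlm]
  generalize Real.exp (-((m - l) * s)) = u at *
  have hp := (one_sub_mul_pos hu hu1 hz).ne'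
  rw [denom_of_gt hl hlm]
  generalize 1 - u * (l / m) = w at *
  field_simp

lemma eq_integral_succ_of_gt (hl : 0 < l) (hlm : l < m) (n : ℕ) :
    degreeLaw l1 l m (n + 1) = (l / m) ^ (n + 2) * (l1 * (m - l) / l ^ 2) *
      ∫ u in (0 : ℝ)..1, u ^ (l1 / (m - l) - 1)
        * (u * ((1 - u) ^ n / (1 - u * (l / m)) ^ (n + 2))) := by
  have h : 0 < m - l := sub_pos.2 hlm
  have hm : 0 < m := hl.trans hlm
  have hz : l / m < 1 := by rwa [div_lt_one hm]
  rw [degreeLaw_eq_integral (l1 := l1) h (n + 1) (fun u => (l / m) ^ (n + 2) * ((m - l) ^ 2 / l ^ 2)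
    * (u * ((1 - u) ^ n / (1 - u * (l / m)) ^ (n + 2)))) fun s hs => ?_]
  · simp_rw [mul_left_comm _ ((l / m) ^ (n + 2) * ((m - l) ^ 2 / l ^ 2))]
    rw [intervalIntegral.integral_const_mul, ← mul_assoc]
    congr 1
    field_simp
  · have hu := Real.exp_pos (-((m - l) * s))
    have hu1 : Real.exp (-((m - l) * s)) ≤ 1 := Real.exp_le_one_iff.2 (by
      have := mul_pos h hs; linarith)
    have e : Real.exp ((l - m) * s) = Real.exp (-((m - l) * s)) := by
      congr 1; ring
    simp only [birthDeathLaw]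
    rw [expIntegral_of_gt hlm, e]
    generalize Real.exp (-((m - l) * s)) = u at *
    have hp := (one_sub_mul_pos hu hu1 hz).ne'
    rw [denom_of_gt hl hlm]
    generalize 1 - u * (l / m) = w at *
    generalize m - l = δ at *
    simp only [mul_pow, div_pow]
    field_simp
    ring

end Subcritical

lemma eq_confluentU_succ (hl : 0 < l) (n : ℕ) :
    degreeLaw l1 l l (n + 1)
      = l1 / l * Real.Gamma (n + 1 : ℕ) * confluentU (n + 1 : ℕ) 0 (l1 / l) := by
  have hΓ : Real.Gamma (n + 1 : ℕ) ≠ 0 := (Real.Gamma_pos_of_pos (by positivity)).ne'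
  have h := integral_comp_mul_left_Ioi
    (fun v => l1 * Real.exp (-(l1 / l) * v) * (v ^ n / (1 + v) ^ (n + 2))) 0 hl
  have e1 : degreeLaw l1 l l (n + 1) = ∫ s in Set.Ioi (0 : ℝ),
      l1 * Real.exp (-(l1 / l) * (l * s)) * ((l * s) ^ n / (1 + l * s) ^ (n + 2)) := by
    refine setIntegral_congr_fun measurableSet_Ioi fun s _ => ?_
    have : -(l1 / l) * (l * s) = -(l1 * s) := by field_simp
    simp only [birthDeathLaw, expIntegral, sub_self, if_true, zero_mul, Real.exp_zero, one_mul,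
      this]
  rw [e1, h, mul_zero, confluentU, smul_eq_mul]
  have e2 : ∫ v in Set.Ioi (0 : ℝ), l1 * Real.exp (-(l1 / l) * v) * (v ^ n / (1 + v) ^ (n + 2))
      = l1 * ∫ v in Set.Ioi (0 : ℝ), Real.exp (-(l1 / l) * v) * v ^ (((n + 1 : ℕ) : ℝ) - 1)
        * (1 + v) ^ ((0 : ℝ) - ((n + 1 : ℕ) : ℝ) - 1) := by
    rw [← integral_const_mul]
    refine setIntegral_congr_fun measurableSet_Ioi fun v hv => ?_
    have hv' : 0 < 1 + v := by have : 0 < v := hv; linarith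
    have e3 : ((n + 1 : ℕ) : ℝ) - 1 = n := by push_cast; ring
    have e4 : (0 : ℝ) - ((n + 1 : ℕ) : ℝ) - 1 = -((n + 2 : ℕ) : ℝ) := by push_cast; ring
    rw [e3, e4, Real.rpow_neg hv'.le, Real.rpow_natCast, Real.rpow_natCast]
    field_simp
  rw [e2]
  field_simp

end degreeLaw

theorem theorem3 {Ω : Type*} [MeasurableSpace Ω] (P : Measure Ω) [IsProbabilityMeasure P]
    (l1 l2 m2 : ℝ) (hl1 : 0 < l1) (hl2 : 0 < l2) (hm2 : 0 ≤ m2)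
    (d : ℕ → Ω → DegSeq) (hd : IsInDegreeChain l1 l2 m2 P d)
    (D : ℕ → Ω → ℕ) (hD : IsUniformVertexDegree P d D) :
    ∃ p : ℕ → ℝ,
      (∀ j : ℕ, Tendsto (fun t : ℕ => P.real {ω | D t ω = j}) atTop (𝓝 (p j))) ∧
      (m2 = 0 →
        p 0 = 0 ∧
        ∀ j : ℕ, 1 ≤ j → p j = l1 / l2 * ProbabilityTheory.beta j (1 + l1 / l2)) ∧
      (0 < m2 → m2 < l2 →
        p 0 = m2 * l1 / (l2 * (l2 - m2)) * ProbabilityTheory.beta 2 (l1 / (l2 - m2))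
            * gaussF 1 (l1 / (l2 - m2)) (2 + l1 / (l2 - m2)) (m2 / l2) ∧
        ∀ j : ℕ, 1 ≤ j →
          p j = l1 * (l2 - m2) / l2 ^ 2 * ProbabilityTheory.beta j (1 + l1 / (l2 - m2))
            * gaussF (j + 1) (1 + l1 / (l2 - m2)) (j + 1 + l1 / (l2 - m2)) (m2 / l2)) ∧
      (0 < m2 → l2 < m2 →
        p 0 = l1 / (m2 - l2) * ProbabilityTheory.beta 2 (l1 / (m2 - l2))
            * gaussF 1 (l1 / (m2 - l2)) (2 + l1 / (m2 - l2)) (l2 / m2) ∧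
        ∀ j : ℕ, 1 ≤ j →
          p j = (l2 / m2) ^ (j + 1) * (l1 * (m2 - l2) / l2 ^ 2)
            * ProbabilityTheory.beta j (1 + l1 / (m2 - l2))
            * gaussF (j + 1) (1 + l1 / (m2 - l2)) (j + 1 + l1 / (m2 - l2)) (l2 / m2)) ∧
      (0 < m2 → l2 = m2 →
        p 0 = confluentU 1 0 (l1 / l2) ∧
        ∀ j : ℕ, 1 ≤ j →
          p j = l1 / l2 * Real.Gamma j * confluentU j 0 (l1 / l2)) := by
  refine ⟨degreeLaw l1 l2 m2, hd.tendsto_degreeLaw hl1 hl2 hm2 hD, ?_, ?_, ?_, ?_⟩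
  · rintro rfl
    refine ⟨?_, fun j hj => ?_⟩
    · have h := degreeLaw.stationary_zero hl1 hl2 le_rfl
      rw [zero_mul, zero_eq_mul] at h
      exact h.resolve_left hl1.ne'
    · obtain ⟨n, rfl⟩ := Nat.exists_eq_succ_of_ne_zero (by omega : j ≠ 0)
      rw [Nat.succ_eq_add_one, degreeLaw.eq_integral_succ_of_lt hl2 hl2, beta_comm,
        beta_eq_integral (by positivity) (by positivity), sub_zero]
      congr 1
      · field_simp
      · refine intervalIntegral.integral_congr_ae (Eventually.of_forall fun s hs => ?_)
        rw [Set.uIoc_of_le zero_le_one] at hs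
        have e1 : ((n + 1 : ℕ) : ℝ) - 1 = n := by push_cast; ring
        rw [e1, Real.rpow_natCast, add_sub_cancel_left, Real.rpow_sub_one hs.1.ne']
        have := hs.1.ne'
        simp only [zero_div, mul_zero, sub_zero, one_pow, div_one]
        field_simp
  · intro hm hml
    have hr : 0 < l1 / (l2 - m2) := div_pos hl1 (sub_pos.2 hml)
    refine ⟨?_, fun j hj => ?_⟩
    · rw [degreeLaw.eq_integral_zero_of_lt hl2 hml, mul_assoc _ (ProbabilityTheory.beta _ _),
        beta_mul_gaussF_zero hr]
    · obtain ⟨n, rfl⟩ := Nat.exists_eq_succ_of_ne_zero (by omega : j ≠ 0)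
      rw [Nat.succ_eq_add_one, degreeLaw.eq_integral_succ_of_lt hl2 hml,
        mul_assoc _ (ProbabilityTheory.beta _ _), beta_mul_gaussF_succ hr]
  · intro hm hlm
    have hr : 0 < l1 / (m2 - l2) := div_pos hl1 (sub_pos.2 hlm)
    refine ⟨?_, fun j hj => ?_⟩
    · rw [degreeLaw.eq_integral_zero_of_gt hl2 hlm, mul_assoc _ (ProbabilityTheory.beta _ _),
        beta_mul_gaussF_zero hr]
    · obtain ⟨n, rfl⟩ := Nat.exists_eq_succ_of_ne_zero (by omega : j ≠ 0)
      rw [Nat.succ_eq_add_one, degreeLaw.eq_integral_succ_of_gt hl2 hlm,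
        mul_assoc _ (ProbabilityTheory.beta _ _), beta_mul_gaussF_succ hr]
  · rintro hm rfl
    refine ⟨?_, fun j hj => ?_⟩
    · -- the formula for degree one transfers to degree zero by stationarity
      have h := degreeLaw.stationary_zero hl1 hl2 hl2.le
      have h1 := degreeLaw.eq_confluentU_succ (l1 := l1) hl2 0
      simp only [zero_add, Nat.cast_one, Real.Gamma_one, mul_one] at h1
      rw [h1] at h
      refine mul_left_cancel₀ hl1.ne' (h.symm.trans ?_)
      field_simp
    · obtain ⟨n, rfl⟩ := Nat.exists_eq_succ_of_ne_zero (by omega : j ≠ 0)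
      exact degreeLaw.eq_confluentU_succ hl2 n
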